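/- **Theorem.** Let $X=\{0,1\}$, let $\nu$ be the uniform Bernoulli measure on $X^{\omega}$, and let $\mathfrak G=\langle a,b,c,d\rangle$ be the Grigorchuk group acting on $X^\omega$ by $a(0w)=1w,\ a(1w)=0w,\ b(0w)=0a(w),\ b(1w)=1c(w),\ c(0w)=0a(w),\ c(1w)=1d(w),\ d(0w)=0w,\ d(1w)=1b(w)$. Let $\pi$ be the unitary representation of $\mathfrak G$ on $H=L^2(X^\omega,\nu)$ given by $(\pi(g)f)(x)=f(g^{-1}x)$, extended linearly to $\mathbb C[\mathfrak G]$. For $\lambda,\mu\in\mathbb R$ put $$R(\lambda,\mu)=\pi\bigl(-\lambda a+b+c+d-(\mu+1)\bigr),\qquad R_n(\lambda,\mu)=-\lambda a_n+b_n+c_n+d_n-(\mu+1)1_n ,$$ where the $2^n\times 2^n$ matrices are given by $a_0=b_0=c_0=d_0=1$ and $a_{n+1}=\begin{pmatrix}0&1\\1&0\end{pmatrix}$, $b_{n+1}=\begin{pmatrix}a_n&0\\0&c_n\end{pmatrix}$, $c_{n+1}=\begin{pmatrix}a_n&0\\0&d_n\end{pmatrix}$, $d_{n+1}=\begin{pmatrix}1&0\\0&b_n\end{pmatrix}$.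 Let $\Sigma$ (respectively $\Sigma_n$, $n\ge 0$) be the set of $(\lambda,\mu)\in\mathbb R^2$ for which $R(\lambda,\mu)$ (respectively $R_n(\lambda,\mu)$) is not invertible. Let $T_x$ ($x\in X$) be the isometries of $H$ with $(T_xf)(xw)=\sqrt2\,f(w)$ and $(T_xf)(yw)=0$ for $y\neq x$. For a bounded operator $M$ on $H$ write $A=T_0^*MT_0$, $B=T_0^*MT_1$, $C=T_1^*MT_0$, $D=T_1^*MT_1$; the Schur complements of $M$ are $S_1(M)=A-BD^{-1}C$ (defined if $D$ is invertible) and $S_2(M)=D-CA^{-1}B$ (defined if $A$ is invertible). Consider the rational maps $$F(\lambda,\mu)=\Bigl(\tfrac{2(4-\mu^2)}{\lambda^2},\,-\mu-\tfrac{\mu(4-\mu^2)}{\lambda^2}\Bigr),\qquad G(\lambda,\mu)=\Bigl(\tfrac{2\lambda^2}{4-\mu^2},\,\mu+\tfrac{\mu\lambda^2}{4-\mu^2}\Bigr),$$ which in homogeneous coordinates $(\lambda,\mu)=(l:m:w)=(l/w,m/w)$ are $$\widehat F(l,m,w)=\bigl(2w(4w^2-m^2),\,-m(l^2+4w^2-m^2),\,wl^2\bigr),\quad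 \widehat G(l,m,w)=\bigl(2wl^2,\,m(4w^2-m^2+l^2),\,w(4w^2-m^2)\bigr),$$ and let $R(l:m:w)=\pi\bigl(-la+w(b+c+d)-(m+w)\bigr)$. Put $U=\{(\lambda,\mu)\in\mathbb R^2:\mu\ne\pm2\}$ and let $\alpha:[-1,1]\to[-1,1]$, $\alpha(x)=2x^2-1$. Then: **I.** For all real $l,m,w$, each of $S_1$ and $S_2$ is defined on $R(l:m:w)$ if and only if $m^2\neq 4w^2$, and in that case, up to multiplication by a non-zero scalar, $S_1(R(l:m:w))=R(\widehat F(l,m,w))$ and $S_2(R(l:m:w))=R(\widehat G(l,m,w))$. In particular, for $\mu\neq\pm2$ and up to non-zero scalars, $S_1(R(\lambda,\mu))=R(F(\lambda,\mu))$ if $\lambda\ne0$, and $S_2(R(\lambda,\mu))=R(G(\lambda,\mu))$. **II.** On the domain $U$ of the Schur maps, $\Sigma$ is invariant under $F$ and $G$: $$\Sigma\cap U=F^{-1}\Sigma\cap U=G^{-1}\Sigma ,$$ and $\Sigma_{n+1}\cap U=F^{-1}\Sigma_n\cap U=G^{-1}\Sigma_n$ for every $n\ge0$. Here $F^{-1}$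 and $G^{-1}$ are preimages under the partial maps $F$ (defined for $\lambda\ne0$) and $G$ (defined for $\mu\ne\pm2$). **III.** $\Sigma=\{(\lambda,\mu)\in\mathbb R^2:\ \bigl||\lambda|-2\bigr|\le|\mu|\le|\lambda|+2\}$. **IV.** $\Sigma_0$ is the line $\lambda+\mu-2=0$. For $n\ge1$, $\Sigma_n$ is the union of the lines $\lambda+\mu-2=0$ and $\lambda-\mu+2=0$ and of the hyperbolas $4-\mu^2+\lambda^2+4\lambda\theta=0$, $\theta\in\bigcup_{0\le i\le n-2}\alpha^{-i}(0)$ (no hyperbolas for $n=1$). -/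

import Mathlib

open MeasureTheory
open scoped ENNReal

noncomputable section

namespace Grigorchuk

/-! ### The automaton and its action on infinite words -/

/-- The states of the automaton: the trivial state and the four generators. -/
inductive State
  | e | a | b | c | d
  deriving DecidableEq

/-- The first letter of `g(xw)`; the letters `0`, `1` are `false`, `true`. -/
def State.out : State → Bool → Bool
  | .a, x => !x
  | _, x => x

/-- The restriction `g|ₓ`, so that `g(xw) = (g.out x) (g.step x)(w)`. -/
def State.step : State → Bool → State
  | .b, false => .a
  | .b, true => .c
  | .c, false => .a
  | .c, true => .d
  | .d, true => .b
  | _, _ => .e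

/-- The boundary of the binary tree. -/
abbrev Word : Type := ℕ → Bool

/-- The restriction of `g` in the prefix of length `n` of the word `x`. -/
def run (g : State) (x : Word) : ℕ → State
  | 0 => g
  | n + 1 => (run g x n).step (x n)

/-- The action of a state on infinite words. -/
def act (g : State) (x : Word) : Word := fun n => (run g x n).out (x n)

/-- Put a letter in front of a word. -/
def consWord (x : Bool) (w : Word) : Word
  | 0 => x
  | n + 1 => w n

theorem run_cons (g : State) (x : Bool) (w : Word) (n : ℕ) :
    run g (consWord x w) (n + 1) = run (g.step x) w n := by
  induction n with
  | zero => rfl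
  | succ n ih => rw [run, ih]; rfl

/-- The recursion `g(xw) = g(x) g|ₓ(w)`. -/
theorem act_cons (g : State) (x : Bool) (w : Word) :
    act g (consWord x w) = consWord (g.out x) (act (g.step x) w) := by
  funext n
  cases n with
  | zero => rfl
  | succ n => simp only [act, run_cons, consWord]

theorem run_act (g : State) (x : Word) (n : ℕ) : run g (act g x) n = run g x n := by
  induction n with
  | zero => rfl
  | succ n ih =>
    rw [run, run, ih, act]
    cases run g x n <;> cases x n <;> rfl

theorem act_act (g : State) (x : Word) : act g (act g x) = x := by
  funext n
  rw [act, run_act, act]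
  cases run g x n <;> cases x n <;> rfl

/-- A state as a permutation of the boundary of the tree (every state is an involution). -/
def perm (g : State) : Equiv.Perm Word :=
  ⟨act g, act g, act_act g, act_act g⟩

/-- The Grigorchuk group, acting on the boundary of the tree. -/
def grigorchukGroup : Subgroup (Equiv.Perm Word) :=
  Subgroup.closure {perm .a, perm .b, perm .c, perm .d}

/-! ### The Bernoulli measure -/

/-- The uniform probability measure on the alphabet. -/
def letterMeasure : Measure Bool := (PMF.uniformOfFintype Bool).toMeasure

instance : IsProbabilityMeasure letterMeasure := by
  unfold letterMeasure; infer_instance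

/-- The uniform Bernoulli measure on infinite words. -/
def bernoulli : Measure Word := Measure.infinitePi fun _ => letterMeasure

instance : IsProbabilityMeasure bernoulli := by
  unfold bernoulli; infer_instance

theorem letterMeasure_singleton (x : Bool) : letterMeasure {x} = 2⁻¹ := by
  unfold letterMeasure
  rw [PMF.toMeasure_apply_singleton _ _ (measurableSet_singleton x)]
  simp

/-- The cylinder of words that agree with `v` on the first `n` letters. -/
def cyl (n : ℕ) (v : Word) : Set Word := {x | ∀ i < n, x i = v i}

theorem bernoulli_cyl_shift (k n : ℕ) (v : Word) :
    bernoulli {x | ∀ i < n, x (i + k) = v i} = 2⁻¹ ^ n := by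
  have h : {x : Word | ∀ i < n, x (i + k) = v i} =
      Set.pi (↑((Finset.range n).map (addRightEmbedding k)) : Set ℕ)
        (fun j => {v (j - k)}) := by
    ext x
    simp [Set.mem_pi]
  rw [h, bernoulli, Measure.infinitePi_pi _ (fun i _ => measurableSet_singleton _)]
  simp [letterMeasure_singleton]

theorem bernoulli_cyl (n : ℕ) (v : Word) : bernoulli (cyl n v) = 2⁻¹ ^ n :=
  bernoulli_cyl_shift 0 n v

theorem measurableSet_cyl (n : ℕ) (v : Word) : MeasurableSet (cyl n v) := by
  have : cyl n v = ⋂ i ∈ Set.Iio n, (fun x : Word => x i) ⁻¹' {v i} := by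
    ext x; simp [cyl]
  rw [this]
  exact MeasurableSet.biInter (Set.to_countable _)
    fun i _ => measurable_pi_apply i (measurableSet_singleton _)

theorem isPiSystem_cyl : IsPiSystem {s : Set Word | ∃ n v, s = cyl n v} := by
  rintro _ ⟨n, v, rfl⟩ _ ⟨m, w, rfl⟩ ⟨x, hx1, hx2⟩
  refine ⟨max n m, x, ?_⟩
  ext y
  constructor
  · rintro ⟨h1, h2⟩ i hi
    rcases lt_max_iff.1 hi with h | h
    · rw [h1 i h, hx1 i h]
    · rw [h2 i h, hx2 i h]
  · intro h
    exact ⟨fun i hi => by rw [h i (lt_max_of_lt_left hi), hx1 i hi],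
      fun i hi => by rw [h i (lt_max_of_lt_right hi), hx2 i hi]⟩

theorem generateFrom_cyl :
    (inferInstance : MeasurableSpace Word) =
      MeasurableSpace.generateFrom {s : Set Word | ∃ n v, s = cyl n v} := by
  apply le_antisymm
  · refine iSup_le fun i => ?_
    rw [← measurable_iff_comap_le]
    refine @measurable_to_countable' _ _ _ _ (MeasurableSpace.generateFrom _) _ fun x => ?_
    have h : (fun w : Word => w i) ⁻¹' {x} =
        ⋃ v ∈ {v : Fin (i + 1) → Bool | v (Fin.last i) = x},
          cyl (i + 1) (fun j => if h : j < i + 1 then v ⟨j, h⟩ else false) := by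
      ext w
      simp only [Set.mem_preimage, Set.mem_singleton_iff, Set.mem_iUnion, cyl]
      simp only [Set.mem_ofPred_eq]
      constructor
      · intro hw
        exact ⟨fun j => w j, hw, fun j hj => by simp [hj]⟩
      · rintro ⟨v, hv, h⟩
        rw [h i (Nat.lt_succ_self i), ← hv]
        simp [Fin.last]
    rw [h]
    refine @MeasurableSet.biUnion _ _ (MeasurableSpace.generateFrom _) _ _ (Set.to_countable _)
      fun v _ => MeasurableSpace.measurableSet_generateFrom ⟨_, _, rfl⟩
  · refine MeasurableSpace.generateFrom_le ?_
    rintro _ ⟨n, v, rfl⟩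
    exact measurableSet_cyl n v

theorem measurePreserving_of_cyl {T : Word → Word} (hT : Measurable T)
    (h : ∀ n v, bernoulli (T ⁻¹' cyl n v) = 2⁻¹ ^ n) :
    MeasurePreserving T bernoulli bernoulli := by
  refine ⟨hT, ?_⟩
  have := Measure.isProbabilityMeasure_map (μ := bernoulli) hT.aemeasurable
  refine ext_of_generate_finite _ generateFrom_cyl isPiSystem_cyl ?_ (by simp)
  rintro _ ⟨n, v, rfl⟩
  rw [Measure.map_apply hT (measurableSet_cyl n v), h, bernoulli_cyl]

instance : Fintype State := ⟨{.e, .a, .b, .c, .d}, fun g => by cases g <;> simp⟩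

instance : MeasurableSpace State := ⊤
instance : DiscreteMeasurableSpace State := ⟨fun _ => trivial⟩
theorem measurable_run (g : State) (n : ℕ) : Measurable fun x => run g x n := by
  induction n with
  | zero => exact measurable_const
  | succ n ih =>
    exact (Measurable.of_discrete (f := fun p : State × Bool => p.1.step p.2)).comp
      (ih.prodMk (measurable_pi_apply n))

theorem measurable_act (g : State) : Measurable (act g) :=
  measurable_pi_lambda _ fun n =>
    (Measurable.of_discrete (f := fun p : State × Bool => p.1.out p.2)).comp
      ((measurable_run g n).prodMk (measurable_pi_apply n))

theorem act_congr (g : State) {n : ℕ} {x y : Word} (h : ∀ i < n, x i = y i) :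
    ∀ i < n, act g x i = act g y i := by
  have hr : ∀ i ≤ n, run g x i = run g y i := by
    intro i hi
    induction i with
    | zero => rfl
    | succ i ih => rw [run, run, ih (by lia), h i (by lia)]
  intro i hi
  rw [act, act, hr i hi.le, h i hi]

theorem measurePreserving_act (g : State) : MeasurePreserving (act g) bernoulli bernoulli := by
  refine measurePreserving_of_cyl (measurable_act g) fun n v => ?_
  have : act g ⁻¹' cyl n v = cyl n (act g v) := by
    ext x
    constructor
    · intro h i hi
      have := act_congr g h i hi
      rwa [act_act] at this
    · intro h i hi
      have := act_congr g h i hi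
      rwa [act_act] at this
  rw [this, bernoulli_cyl]

theorem measurePreserving_group (g : Equiv.Perm Word) (hg : g ∈ grigorchukGroup) :
    MeasurePreserving g bernoulli bernoulli ∧
      MeasurePreserving (g⁻¹ : Equiv.Perm Word) bernoulli bernoulli := by
  refine Subgroup.closure_induction (p := fun (g : Equiv.Perm Word) _ =>
      MeasurePreserving g bernoulli bernoulli ∧
      MeasurePreserving (g⁻¹ : Equiv.Perm Word) bernoulli bernoulli) ?_ ?_ ?_ ?_ hg
  · rintro _ (rfl | rfl | rfl | rfl) <;>
      exact ⟨measurePreserving_act _, measurePreserving_act _⟩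
  · exact ⟨MeasurePreserving.id _, MeasurePreserving.id _⟩
  · rintro x y _ _ ⟨hx, hx'⟩ ⟨hy, hy'⟩
    refine ⟨hx.comp hy, ?_⟩
    rw [mul_inv_rev]
    exact hy'.comp hx'
  · rintro x _ ⟨hx, hx'⟩
    exact ⟨hx', by rwa [inv_inv]⟩

/-! ### The representation on square-integrable functions -/

/-- The Hilbert space `L²` of the boundary of the tree with the Bernoulli measure. -/
abbrev HSpace : Type := Lp ℂ 2 bernoulli

/-- The unitary representation `(π(g) f)(x) = f(g⁻¹ x)` of the Grigorchuk group. -/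
def koopman : grigorchukGroup →* (HSpace →L[ℂ] HSpace) where
  toFun g := (Lp.compMeasurePreservingₗᵢ ℂ ((g⁻¹ : grigorchukGroup) : Equiv.Perm Word)
    (measurePreserving_group _ (g⁻¹).2).1).toContinuousLinearMap
  map_one' := by
    ext1 f
    exact Lp.compMeasurePreserving_id_apply f
  map_mul' g h := by
    ext1 f
    exact Lp.compMeasurePreserving_comp_apply (g := f) (measurePreserving_group _ (h⁻¹).2).1
      (measurePreserving_group _ (g⁻¹).2).1

/-- The linear extension of the representation to the group algebra. -/
def rep : MonoidAlgebra ℂ grigorchukGroup →ₐ[ℂ] (HSpace →L[ℂ] HSpace) :=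
  MonoidAlgebra.lift ℂ _ _ koopman

/-- The generators in the group algebra. -/
def genA : MonoidAlgebra ℂ grigorchukGroup :=
  MonoidAlgebra.of ℂ _ ⟨perm .a, Subgroup.subset_closure (by simp)⟩
def genB : MonoidAlgebra ℂ grigorchukGroup :=
  MonoidAlgebra.of ℂ _ ⟨perm .b, Subgroup.subset_closure (by simp)⟩
def genC : MonoidAlgebra ℂ grigorchukGroup :=
  MonoidAlgebra.of ℂ _ ⟨perm .c, Subgroup.subset_closure (by simp)⟩
def genD : MonoidAlgebra ℂ grigorchukGroup :=
  MonoidAlgebra.of ℂ _ ⟨perm .d, Subgroup.subset_closure (by simp)⟩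

/-- The pencil `R(lam, mu) = -lam a + b + c + d - (mu + 1)`. -/
def pencil (lam mu : ℝ) : MonoidAlgebra ℂ grigorchukGroup :=
  -((lam : ℂ) • genA) + genB + genC + genD - ((mu : ℂ) + 1) • 1

/-- The pencil in homogeneous coordinates:
`R(l : m : w) = -l a + w (b + c + d) - (m + w)`, so that `R(lam : mu : 1) = R(lam, mu)`. -/
def homPencil (v : ℝ × ℝ × ℝ) : MonoidAlgebra ℂ grigorchukGroup :=
  -((v.1 : ℂ) • genA) + (v.2.2 : ℂ) • (genB + genC + genD) - ((v.2.1 : ℂ) + (v.2.2 : ℂ)) • 1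

/-- The spectrum of the pencil. -/
def SigmaSet : Set (ℝ × ℝ) := {p | ¬ IsUnit (rep (pencil p.1 p.2))}

/-! ### The 2-similarity and the Schur complements -/

/-- The one-sided shift. -/
def shift (x : Word) : Word := fun n => x (n + 1)

theorem measurePreserving_shift : MeasurePreserving shift bernoulli bernoulli :=
  measurePreserving_of_cyl (measurable_pi_lambda _ fun n => measurable_pi_apply (n + 1))
    fun n v => bernoulli_cyl_shift 1 n v

/-- The words that start with a given letter. -/
def firstLetter (x : Bool) : Set Word := {w | w 0 = x}

theorem measurableSet_firstLetter (x : Bool) : MeasurableSet (firstLetter x) :=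
  (measurable_pi_apply (X := fun _ : ℕ => Bool) 0) (measurableSet_singleton x)

/-- The isometry `Tₓ` of the natural 2-similarity:
`(Tₓ f)(x w) = √2 f(w)`, and `(Tₓ f)(y w) = 0` for the other letter `y`. -/
def creation (x : Bool) : HSpace →L[ℂ] HSpace :=
  ((√2 : ℝ) : ℂ) •
    ((ContinuousLinearMap.lsmul ℂ ℂ).holderL bernoulli ∞ 2 2
        (indicatorConstLp ∞ (measurableSet_firstLetter x) (measure_ne_top _ _) (1 : ℂ))).comp
      (Lp.compMeasurePreservingₗᵢ ℂ shift measurePreserving_shift).toContinuousLinearMap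

theorem creation_apply (x : Bool) (f : HSpace) :
    creation x f =ᵐ[bernoulli]
      fun w => if w 0 = x then ((√2 : ℝ) : ℂ) * f (shift w) else 0 := by
  have h1 := Lp.coeFn_smul ((√2 : ℝ) : ℂ)
    ((ContinuousLinearMap.lsmul ℂ ℂ).holderL bernoulli ∞ 2 2
        (indicatorConstLp ∞ (measurableSet_firstLetter x) (measure_ne_top _ _) (1 : ℂ))
      (Lp.compMeasurePreserving shift measurePreserving_shift f))
  have h2 := (ContinuousLinearMap.lsmul ℂ ℂ : ℂ →L[ℂ] ℂ →L[ℂ] ℂ).coeFn_holder (r := 2)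
        (indicatorConstLp ∞ (measurableSet_firstLetter x)
          (measure_ne_top bernoulli _) (1 : ℂ))
      (Lp.compMeasurePreserving shift measurePreserving_shift f)
  have h3 : indicatorConstLp ∞ (measurableSet_firstLetter x) (measure_ne_top bernoulli _) (1 : ℂ)
      =ᵐ[bernoulli] _ := indicatorConstLp_coeFn
  have h4 := Lp.coeFn_compMeasurePreserving f measurePreserving_shift
  filter_upwards [h1, h2, h3, h4] with w h1 h2 h3 h4
  refine h1.trans ?_
  rw [Pi.smul_apply]
  refine (congrArg _ h2).trans ?_
  rw [h3, h4]
  by_cases hw : w 0 = x <;> simp [hw, firstLetter, Set.indicator]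

/-- The entry `(y, x)` of the operator matrix of `M` with respect to the 2-similarity. -/
def block (M : HSpace →L[ℂ] HSpace) (y x : Bool) : HSpace →L[ℂ] HSpace :=
  (ContinuousLinearMap.adjoint (creation y)).comp (M.comp (creation x))

/-- The first Schur complement `A - B D⁻¹ C`; it is defined if `D = block M true true` is
invertible. -/
def schur₁ (M : HSpace →L[ℂ] HSpace) : HSpace →L[ℂ] HSpace :=
  block M false false -
    block M false true * Ring.inverse (block M true true) * block M true false

/-- The second Schur complement `D - C A⁻¹ B`; it is defined if `A = block M false false` is
invertible. -/
def schur₂ (M : HSpace →L[ℂ] HSpace) : HSpace →L[ℂ] HSpace :=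
  block M true true -
    block M true false * Ring.inverse (block M false false) * block M false true

/-- Two operators have the same class modulo multiplication by non-zero scalars. -/
def SameClass (S T : HSpace →L[ℂ] HSpace) : Prop := ∃ t : ℂ, t ≠ 0 ∧ S = t • T

/-! ### The finite-dimensional approximations -/

/-- The matrix `g⁽ⁿ⁾` of a state on words of length `n`, by the matrix recursion: `g⁽⁰⁾ = 1`, and
the block `(y, x)` of `g⁽ⁿ⁺¹⁾` is `(g|ₓ)⁽ⁿ⁾` if `g(x) = y` and `0` otherwise. -/
def levelMatrix : (n : ℕ) → State → Matrix (Fin n → Bool) (Fin n → Bool) ℂ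
  | 0, _ => 1
  | n + 1, g => Matrix.of fun v u =>
      if g.out (u 0) = v 0 then levelMatrix n (g.step (u 0)) (Fin.tail v) (Fin.tail u) else 0

/-- `Rₙ(lam, mu) = -lam aₙ + bₙ + cₙ + dₙ - (mu + 1)`. -/
def levelPencil (n : ℕ) (lam mu : ℝ) : Matrix (Fin n → Bool) (Fin n → Bool) ℂ :=
  -((lam : ℂ) • levelMatrix n .a) + levelMatrix n .b + levelMatrix n .c + levelMatrix n .d
    - ((mu : ℂ) + 1) • (1 : Matrix (Fin n → Bool) (Fin n → Bool) ℂ)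

/-- The spectrum of the pencil on level `n`. -/
def SigmaLevel (n : ℕ) : Set (ℝ × ℝ) := {p | ¬ IsUnit (levelPencil n p.1 p.2)}

/-! ### The rational maps -/

/-- The rational map `F`, meaningful for `p.1 ≠ 0`. -/
def F (p : ℝ × ℝ) : ℝ × ℝ :=
  (2 * (4 - p.2 ^ 2) / p.1 ^ 2, -p.2 - p.2 * (4 - p.2 ^ 2) / p.1 ^ 2)

/-- The rational map `G`, meaningful for `p.2 ^ 2 ≠ 4`. -/
def G (p : ℝ × ℝ) : ℝ × ℝ :=
  (2 * p.1 ^ 2 / (4 - p.2 ^ 2), p.2 + p.2 * p.1 ^ 2 / (4 - p.2 ^ 2))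

/-- `F` in homogeneous coordinates `(l : m : w)`. -/
def homF : ℝ × ℝ × ℝ → ℝ × ℝ × ℝ := fun (l, m, w) =>
  (2 * w * (4 * w ^ 2 - m ^ 2), -(m * (l ^ 2 + 4 * w ^ 2 - m ^ 2)), w * l ^ 2)

/-- `G` in homogeneous coordinates `(l : m : w)`. -/
def homG : ℝ × ℝ × ℝ → ℝ × ℝ × ℝ := fun (l, m, w) =>
  (2 * w * l ^ 2, m * (4 * w ^ 2 - m ^ 2 + l ^ 2), w * (4 * w ^ 2 - m ^ 2))

theorem homPencil_affine (lam mu : ℝ) : homPencil (lam, mu, 1) = pencil lam mu := by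
  simp [homPencil, pencil, add_assoc]

theorem homF_affine (p : ℝ × ℝ) (h : p.1 ≠ 0) :
    homF (p.1, p.2, 1) = p.1 ^ 2 • ((F p).1, (F p).2, (1 : ℝ)) := by
  ext <;> simp [homF, F] <;> field_simp
  ring

theorem homG_affine (p : ℝ × ℝ) (h : p.2 ^ 2 ≠ 4) :
    homG (p.1, p.2, 1) = (4 - p.2 ^ 2) • ((G p).1, (G p).2, (1 : ℝ)) := by
  have h' : 4 - p.2 ^ 2 ≠ 0 := fun h0 => h (by linarith)
  ext <;> simp [homG, G] <;> field_simp

/-! ### The description of the spectra -/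

/-- The complement of the lines `mu = 2` and `mu = -2`. -/
def schurDomain : Set (ℝ × ℝ) := {p | p.2 ^ 2 ≠ 4}

/-- The hyperbola `4 - mu² + lam² + 4 lam θ = 0`. -/
def hyperbola (θ : ℝ) : Set (ℝ × ℝ) := {p | 4 - p.2 ^ 2 + p.1 ^ 2 + 4 * p.1 * θ = 0}

/-- The interval map `α : [-1, 1] → [-1, 1]`, `α x = 2 x² - 1`. -/
def alpha (x : Set.Icc (-1 : ℝ) 1) : Set.Icc (-1 : ℝ) 1 :=
  ⟨2 * (x : ℝ) ^ 2 - 1, by nlinarith [sq_nonneg (x : ℝ)],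
    by nlinarith [x.2.1, x.2.2, mul_nonneg (sub_nonneg.2 x.2.1) (sub_nonneg.2 x.2.2)]⟩

end Grigorchuk

end

open Grigorchuk

/-! Write `A = π(a)` and `S = π(b + c + d - 1)`. Then `A² = 1`, and `S² = 4` because `b, c, d` are
the involutions of a Klein four-group. The pencil is `-l A + S - m`, and with `Q = A S + S A` one
has `(-l A + S - m)(-l A + S + m) = 4 - m² + l² - l Q`. The problem therefore reduces to the
spectrum of `Q`. Since `‖Q‖ ≤ 4`, the pencil is invertible when `4|l| < |4 - m² + l²|`
(`isUnit_rep_pencil`). Conversely, an eigenvalue `4c` of `Q` with `c² ≠ 1` gives a kernel vector of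
the pencil at every point of a hyperbola (`exists_kernel_of_eigenvector`).

Eigenvalues come from self-similarity. In block form `A` is the swap and `S` is `diag(2A, S)`, so
`Q` has zero diagonal and both off-diagonal entries equal to `2A + S`, where `(2A + S)² = 8 + 2Q`.
An eigenvalue `4c` of the extended `Q` thus lies over the eigenvalue `4(2c² - 1) = 4 α(c)`. Starting
from joint eigenvectors of `A` and `S`, one gets the eigenvalue `0`, then `4θ` for every `θ` in the
backward orbit of `0` under `α`. As `α` is angle doubling on cosines, this orbit is dense in `[-1,
1]`, and closedness of the spectrum fills in the remaining hyperbolas (`hyperbola_subset_SigmaSet`).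

On level `n` the same recursion is run downwards to find all eigenvalues of `Q`
(`eigenvalue_level`). The values `±4` are special: their eigenvectors are joint eigenvectors of `A`
and `S`, so only one of the two lines of the degenerate conic survives.

The Schur complements are computed from the same block form, since `(wE - m)(wE + m) = 4w² - m²` for
`E = S` and `E = 2A`. On the levels, invariance under `F` and `G` is block elimination; for the full
spectrum it follows from its defining inequality. -/

namespace Grigorchuk

/-! ### Pairs of operators with `A² = 1` and `S² = 4` -/

section Involutions

variable {V W : Type*} [AddCommGroup V] [Module ℂ V] [AddCommGroup W] [Module ℂ W]

/-- An eigenvector of `A S + S A` with eigenvalue `4 c ≠ ±4` yields a kernel vector of each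
pencil `-l A + S - m` with `4 - m² + l² = 4 l c`. -/
theorem exists_kernel_of_eigenvector {A S : V →ₗ[ℂ] V} (hA : ∀ v, A (A v) = v)
    (hS : ∀ v, S (S v) = (4 : ℂ) • v) {c l m : ℂ} (hc : c ^ 2 ≠ 1)
    (hlm : 4 - m ^ 2 + l ^ 2 = 4 * l * c) {v : V} (hv : v ≠ 0)
    (hQ : A (S v) + S (A v) = (4 * c) • v) :
    ∃ w, w ≠ 0 ∧ -(l • A w) + S w - m • w = 0 := by
  by_contra! hcon
  -- On eigenvectors of `A S + S A`, the pencils at `m` and `-m` multiply to `4 - m² + l² - 4lc =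
  -- 0`, so a nonzero image under the pencil at `-m` would be a kernel vector.
  have key : ∀ v, A (S v) + S (A v) = (4 * c) • v → -(l • A v) + S v + m • v = 0 := by
    intro v hQ
    by_contra hne
    refine hcon _ hne ?_
    simp only [map_add, map_neg, map_smul, hA, hS]
    have h0 : (4 - m ^ 2 + l ^ 2 - 4 * l * c) • v = 0 := by rw [hlm, sub_self, zero_smul]
    linear_combination (norm := module) (-l) • hQ + h0
  have h1 := key v hQ
  have h2 := key (A v) (by
    rw [hA, ← map_smul A, ← hQ, map_add, hA, add_comm])
  rw [hA] at h2
  -- Both `v` and `A v` are killed by the pencil at `-m`, which makes `A` and `S` commute on `v`;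
  -- then `S v = 2c A v`, and `S² = 4` forces `c² = 1`.
  have h3 : A (S v) = S (A v) := by
    have h4 := congrArg A h1
    simp only [map_add, map_neg, map_smul, hA, map_zero] at h4
    linear_combination (norm := module) h4 - h2
  have h5 : A (S v) = (2 * c) • v := by
    linear_combination (norm := module) (1 / 2 : ℂ) • hQ + (1 / 2 : ℂ) • h3
  have h6 : S v = (2 * c) • A v := by rw [← map_smul, ← h5, hA]
  have h7 : (4 : ℂ) • v = (4 * c ^ 2) • v := by
    rw [← hS, h6, map_smul, ← h3, h5, smul_smul]; ring_nf
  have h8 : (4 - 4 * c ^ 2) • v = 0 := by rw [sub_smul, h7, sub_self]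
  rcases smul_eq_zero.1 h8 with h | h
  · exact hc (by linear_combination (-1 / 4 : ℂ) * h)
  · exact hv h

/-- The pair `(A', S')` on `W` is the extension of the pair `(A, S)` on `V` by the matrix recursion
of the Grigorchuk group. -/
structure IsExtension (A S : V →ₗ[ℂ] V) (A' S' : W →ₗ[ℂ] W) (j : Bool → V →ₗ[ℂ] W) : Prop where
  map_A : ∀ x v, A' (j x v) = j (!x) v
  map_S_false : ∀ v, S' (j false v) = (2 : ℂ) • j false (A v)
  map_S_true : ∀ v, S' (j true v) = j true (S v)
  eq_zero : ∀ v₀ v₁, j false v₀ + j true v₁ = 0 → v₀ = 0 ∧ v₁ = 0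

namespace IsExtension

variable {A S : V →ₗ[ℂ] V} {A' S' : W →ₗ[ℂ] W} {j : Bool → V →ₗ[ℂ] W}

theorem ne_zero (h : IsExtension A S A' S' j) {v₀ : V} (hv : v₀ ≠ 0) (v₁ : V) :
    j false v₀ + j true v₁ ≠ 0 :=
  fun h0 => hv (h.eq_zero _ _ h0).1

theorem A_add (h : IsExtension A S A' S' j) (v₀ v₁ : V) :
    A' (j false v₀ + j true v₁) = j false v₁ + j true v₀ := by
  rw [map_add, h.map_A, h.map_A, add_comm]; rfl

theorem S_add (h : IsExtension A S A' S' j) (v₀ v₁ : V) :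
    S' (j false v₀ + j true v₁) = j false ((2 : ℂ) • A v₀) + j true (S v₁) := by
  rw [map_add, h.map_S_false, h.map_S_true, map_smul]

/-- Since `A'` swaps the two blocks and `S'` preserves them, the anticommutator is off-diagonal,
with `2A + S` in both places. -/
theorem Q_add (h : IsExtension A S A' S' j) (v₀ v₁ : V) :
    A' (S' (j false v₀ + j true v₁)) + S' (A' (j false v₀ + j true v₁)) =
      j false ((2 : ℂ) • A v₁ + S v₁) + j true ((2 : ℂ) • A v₀ + S v₀) := by
  rw [h.S_add, h.A_add, h.A_add, h.S_add]
  simp only [map_add]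
  abel

theorem inj (h : IsExtension A S A' S' j) {v₀ v₁ w₀ w₁ : V}
    (he : j false v₀ + j true v₁ = j false w₀ + j true w₁) : v₀ = w₀ ∧ v₁ = w₁ := by
  have := h.eq_zero (v₀ - w₀) (v₁ - w₁) (by
    rw [map_sub, map_sub]; linear_combination (norm := module) he)
  exact ⟨sub_eq_zero.1 this.1, sub_eq_zero.1 this.2⟩

theorem Q_eq_smul_iff (h : IsExtension A S A' S' j) (v₀ v₁ : V) (c : ℂ) :
    A' (S' (j false v₀ + j true v₁)) + S' (A' (j false v₀ + j true v₁)) =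
        c • (j false v₀ + j true v₁) ↔
      (2 : ℂ) • A v₁ + S v₁ = c • v₀ ∧ (2 : ℂ) • A v₀ + S v₀ = c • v₁ := by
  rw [h.Q_add, smul_add, ← map_smul (j false) c, ← map_smul (j true) c]
  exact ⟨h.inj, fun ⟨h0, h1⟩ => by rw [h0, h1]⟩

theorem pencil_eq_zero_iff (h : IsExtension A S A' S' j) (v₀ v₁ : V) (l m : ℂ) :
    -(l • A' (j false v₀ + j true v₁)) + S' (j false v₀ + j true v₁)
        - m • (j false v₀ + j true v₁) = 0 ↔
      (2 : ℂ) • A v₀ - m • v₀ = l • v₁ ∧ S v₁ - m • v₁ = l • v₀ := by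
  have e : -(l • A' (j false v₀ + j true v₁)) + S' (j false v₀ + j true v₁)
        - m • (j false v₀ + j true v₁) =
      j false ((2 : ℂ) • A v₀ - m • v₀ - l • v₁) + j true (S v₁ - m • v₁ - l • v₀) := by
    rw [h.A_add, h.S_add]
    simp only [map_sub, map_smul]
    module
  rw [e]
  constructor
  · intro h0
    have := h.eq_zero _ _ h0
    exact ⟨sub_eq_zero.1 this.1, sub_eq_zero.1 this.2⟩
  · rintro ⟨h0, h1⟩
    rw [h0, h1]; simp

end IsExtension

/-! ### Eigenvalues of the anticommutator under extension -/

theorem sq_two_A_add_S {A S : V →ₗ[ℂ] V} (hA : ∀ v, A (A v) = v)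
    (hS : ∀ v, S (S v) = (4 : ℂ) • v) (v : V) :
    (2 : ℂ) • A ((2 : ℂ) • A v + S v) + S ((2 : ℂ) • A v + S v) =
      (8 : ℂ) • v + (2 : ℂ) • (A (S v) + S (A v)) := by
  simp only [map_add, map_smul, hA, hS]
  module

/-- Descent: applying `2A + S` twice gives `16c² = 8 + 2q`, so each block component of an
eigenvector for `4c` satisfies the equation for `q = 4(2c² - 1)`. The case `c = 0` is included. -/
theorem Q_eq_of_swap {A S : V →ₗ[ℂ] V} (hA : ∀ v, A (A v) = v)
    (hS : ∀ v, S (S v) = (4 : ℂ) • v) {c : ℂ} {v w : V}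
    (hv : (2 : ℂ) • A w + S w = (4 * c) • v) (hw : (2 : ℂ) • A v + S v = (4 * c) • w) :
    A (S v) + S (A v) = (4 * (2 * c ^ 2 - 1)) • v := by
  have h1 := sq_two_A_add_S hA hS v
  rw [hw, map_smul, map_smul] at h1
  linear_combination (norm := module) (-1 / 2 : ℂ) • h1 + (2 * c) • hv

variable {A S : V →ₗ[ℂ] V} {A' S' : W →ₗ[ℂ] W} {j : Bool → V →ₗ[ℂ] W}

/-- Ascent: the second component is forced to be `(4c)⁻¹ (2A + S) v`, which is why `c = 0` needs a
separate source. -/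
theorem IsExtension.exists_eigenvector (h : IsExtension A S A' S' j) (hA : ∀ v, A (A v) = v)
    (hS : ∀ v, S (S v) = (4 : ℂ) • v) {c : ℂ} (hc : c ≠ 0)
    (hV : ∃ v, v ≠ 0 ∧ A (S v) + S (A v) = (4 * (2 * c ^ 2 - 1)) • v) :
    ∃ w, w ≠ 0 ∧ A' (S' w) + S' (A' w) = (4 * c) • w := by
  obtain ⟨v, hv, hQ⟩ := hV
  have hc' : 4 * c ≠ 0 := mul_ne_zero (by norm_num) hc
  refine ⟨_, h.ne_zero hv ((4 * c)⁻¹ • ((2 : ℂ) • A v + S v)), ?_⟩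
  rw [h.Q_eq_smul_iff]
  constructor
  · have h1 := sq_two_A_add_S hA hS v
    rw [map_smul, map_smul, smul_comm, ← smul_add, h1, hQ, inv_smul_eq_iff₀ hc']
    module
  · rw [smul_inv_smul₀ hc']

/-- Here `(2A + S) v = -2v + 2v = 0`, so `v` placed in the first block is annihilated. -/
theorem IsExtension.exists_eigenvector_zero (h : IsExtension A S A' S' j)
    (hV : ∃ v, v ≠ 0 ∧ A v = -v ∧ S v = (2 : ℂ) • v) :
    ∃ w, w ≠ 0 ∧ A' (S' w) + S' (A' w) = (4 * (0 : ℂ)) • w := by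
  obtain ⟨v, hv, hAv, hSv⟩ := hV
  refine ⟨_, h.ne_zero hv 0, ?_⟩
  rw [h.Q_eq_smul_iff, hAv, hSv]
  simp

theorem IsExtension.exists_fixed (h : IsExtension A S A' S' j)
    (hV : ∃ v, v ≠ 0 ∧ A v = v ∧ S v = (2 : ℂ) • v) :
    ∃ w, w ≠ 0 ∧ A' w = w ∧ S' w = (2 : ℂ) • w := by
  obtain ⟨v, hv, hAv, hSv⟩ := hV
  refine ⟨_, h.ne_zero hv v, ?_, ?_⟩
  · rw [h.A_add]
  · rw [h.S_add, hAv, hSv, map_smul, map_smul, smul_add]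

theorem IsExtension.exists_antifixed (h : IsExtension A S A' S' j)
    (hV : ∃ v, v ≠ 0 ∧ A v = v ∧ S v = (2 : ℂ) • v) :
    ∃ w, w ≠ 0 ∧ A' w = -w ∧ S' w = (2 : ℂ) • w := by
  obtain ⟨v, hv, hAv, hSv⟩ := hV
  refine ⟨_, h.ne_zero hv (-v), ?_, ?_⟩
  · rw [h.A_add, map_neg, map_neg, neg_add_rev, neg_neg, add_comm]
  · rw [h.S_add, map_neg, hAv, hSv]
    simp only [map_neg, map_smul]
    module

end Involutions

/-! ### The operators of the generators -/

/-- The operator `f ↦ f ∘ g` of a state on the Hilbert space. -/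
noncomputable def stateOp (g : State) : HSpace →L[ℂ] HSpace :=
  (Lp.compMeasurePreservingₗᵢ ℂ (act g) (measurePreserving_act g)).toContinuousLinearMap

theorem stateOp_apply (g : State) (f : HSpace) :
    stateOp g f =ᵐ[bernoulli] fun w => f (act g w) :=
  Lp.coeFn_compMeasurePreserving f (measurePreserving_act g)

theorem rep_genA : rep genA = stateOp .a := MonoidAlgebra.lift_of _ _
theorem rep_genB : rep genB = stateOp .b := MonoidAlgebra.lift_of _ _
theorem rep_genC : rep genC = stateOp .c := MonoidAlgebra.lift_of _ _
theorem rep_genD : rep genD = stateOp .d := MonoidAlgebra.lift_of _ _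

theorem norm_stateOp_apply (g : State) (f : HSpace) : ‖stateOp g f‖ = ‖f‖ :=
  (Lp.compMeasurePreservingₗᵢ ℂ (act g) (measurePreserving_act g)).norm_map f

theorem act_e (x : Word) : act .e x = x := by
  have h : ∀ n, run .e x n = .e := by
    intro n
    induction n with
    | zero => rfl
    | succ n ih => rw [run, ih]; rfl
  funext n
  rw [act, h]
  rfl

theorem consWord_shift (x : Word) : consWord (x 0) (shift x) = x := by
  funext n
  cases n <;> rfl

theorem act_zero (g : State) (x : Word) : act g x 0 = g.out (x 0) := rfl

theorem shift_act (g : State) (x : Word) : shift (act g x) = act (g.step (x 0)) (shift x) := by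
  conv_lhs => rw [← consWord_shift x, act_cons]
  rfl

/-- The three relations are proved together because restriction at the letter `1` permutes `b → c →
d → b`, and hence the relations, cyclically; at the letter `0` only `a² = 1` is needed. -/
theorem act_klein (n : ℕ) : ∀ x : Word, act .b (act .c x) n = act .d x n ∧
    act .c (act .d x) n = act .b x n ∧ act .d (act .b x) n = act .c x n := by
  induction n with
  | zero => intro x; simp [act_zero, State.out]
  | succ n ih =>
    intro x
    have key : ∀ (g : State) (y : Word), act g y (n + 1) = act (g.step (y 0)) (shift y) n :=
      fun g y => congrFun (shift_act g y) n
    simp only [key, shift_act, act_zero]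
    cases x 0
    · simp [State.out, State.step, act_act, act_e]
    · simpa [State.out, State.step] using ⟨(ih (shift x)).2.1, (ih (shift x)).2.2, (ih (shift x)).1⟩

theorem act_b_act_c (x : Word) : act .b (act .c x) = act .d x := funext fun n => (act_klein n x).1
theorem act_c_act_d (x : Word) : act .c (act .d x) = act .b x := funext fun n => (act_klein n x).2.1
theorem act_d_act_b (x : Word) : act .d (act .b x) = act .c x := funext fun n => (act_klein n x).2.2

theorem stateOp_mul_eq {g h k : State} (H : ∀ x, act h (act g x) = act k x) :
    stateOp g * stateOp h = stateOp k := by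
  ext1 f
  refine Lp.ext ?_
  have h1 := stateOp_apply g (stateOp h f)
  have h2 := (measurePreserving_act g).quasiMeasurePreserving.ae_eq_comp (stateOp_apply h f)
  refine h1.trans (h2.trans ?_)
  filter_upwards [stateOp_apply k f] with x hx
  rw [hx]
  exact congrArg f (H x)

theorem stateOp_e : stateOp .e = 1 := by
  ext1 f
  refine Lp.ext ?_
  filter_upwards [stateOp_apply .e f] with x hx
  rw [hx, act_e]
  rfl

theorem stateOp_mul_self (g : State) : stateOp g * stateOp g = 1 := by
  rw [← stateOp_e]
  exact stateOp_mul_eq fun x => by rw [act_act, act_e]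

theorem isSelfAdjoint_stateOp (g : State) : IsSelfAdjoint (stateOp g) := by
  have h : star (stateOp g) * stateOp g = 1 :=
    (ContinuousLinearMap.norm_map_iff_adjoint_comp_self _).1 (norm_stateOp_apply g)
  have h2 := congrArg (· * stateOp g) h
  simp only [mul_assoc, stateOp_mul_self, mul_one, one_mul] at h2
  exact h2

/-- The operator of `b + c + d - 1`. -/
noncomputable def opS : HSpace →L[ℂ] HSpace := stateOp .b + stateOp .c + stateOp .d - 1

/-- Conceptually, `b + c + d - 1 = 4P - 2`, with `P` the averaging projection of the four-group `{1,
b, c, d}`. -/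
theorem opS_mul_self : opS * opS = (4 : ℂ) • 1 := by
  have hcb : stateOp .c * stateOp .b = stateOp .d := stateOp_mul_eq act_b_act_c
  have hdc : stateOp .d * stateOp .c = stateOp .b := stateOp_mul_eq act_c_act_d
  have hbd : stateOp .b * stateOp .d = stateOp .c := stateOp_mul_eq act_d_act_b
  have hb := stateOp_mul_self .b
  have hc := stateOp_mul_self .c
  have hd := stateOp_mul_self .d
  have hcd : stateOp .c * stateOp .d = stateOp .b := by rw [← hcb, ← mul_assoc, hc, one_mul]
  have hdb : stateOp .d * stateOp .b = stateOp .c := by rw [← hdc, ← mul_assoc, hd, one_mul]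
  have hbc : stateOp .b * stateOp .c = stateOp .d := by rw [← hbd, ← mul_assoc, hb, one_mul]
  simp only [opS, mul_add, add_mul, mul_sub, sub_mul, hb, hc, hd, hcd, hdb, hbc, hcb, hdc, hbd,
    mul_one, one_mul]
  module

theorem isSelfAdjoint_opS : IsSelfAdjoint opS :=
  (((isSelfAdjoint_stateOp _).add (isSelfAdjoint_stateOp _)).add (isSelfAdjoint_stateOp _)).sub
    (IsSelfAdjoint.one _)

theorem rep_homPencil (l m w : ℝ) : rep (homPencil (l, m, w)) =
    -((l : ℂ) • stateOp .a) + (w : ℂ) • opS - (m : ℂ) • 1 := by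
  simp only [homPencil, opS, map_sub, map_add, map_neg, map_smul, map_one, rep_genA, rep_genB,
    rep_genC, rep_genD]
  module

theorem rep_pencil (l m : ℝ) : rep (pencil l m) =
    -((l : ℂ) • stateOp .a) + opS - (m : ℂ) • 1 := by
  rw [← homPencil_affine, rep_homPencil]
  simp

/-! ### The 2-similarity -/

theorem out_out (g : State) (x : Bool) : g.out (g.out x) = x := by
  cases g <;> cases x <;> rfl

theorem step_out (g : State) (x : Bool) : g.step (g.out x) = g.step x := by
  cases g <;> cases x <;> rfl

theorem stateOp_creation (g : State) (x : Bool) (f : HSpace) :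
    stateOp g (creation x f) = creation (g.out x) (stateOp (g.step x) f) := by
  refine Lp.ext ?_
  have h1 := stateOp_apply g (creation x f)
  have h2 := (measurePreserving_act g).quasiMeasurePreserving.ae_eq_comp (creation_apply x f)
  have h3 := creation_apply (g.out x) (stateOp (g.step x) f)
  have h4 := measurePreserving_shift.quasiMeasurePreserving.ae_eq_comp
    (stateOp_apply (g.step x) f)
  filter_upwards [h1, h2, h3, h4] with w h1 h2 h3 h4
  rw [h1, h3]
  refine h2.trans ?_
  simp only [Function.comp_apply] at h4 ⊢
  rw [act_zero, shift_act, h4]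
  by_cases h : w 0 = g.out x
  · rw [if_pos h, if_pos (by rw [h, out_out]), h, step_out]
  · rw [if_neg h, if_neg fun h' => h (by rw [← h', out_out])]

theorem inner_creation_of_ne {x y : Bool} (h : x ≠ y) (f g : HSpace) :
    inner ℂ (creation x f) (creation y g) = 0 := by
  rw [L2.inner_def]
  refine integral_eq_zero_of_ae ?_
  filter_upwards [creation_apply x f, creation_apply y g] with w h1 h2
  rw [h1, h2]
  by_cases hx : w 0 = x
  · rw [if_neg fun hy => h (hx.symm.trans hy)]; simp
  · rw [if_neg hx]; simp

/-- The two images of `f` are orthogonal, are exchanged by the isometry `a`, and add up to `√2`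
times `f` composed with the measure-preserving shift. -/
theorem norm_creation_apply (x : Bool) (f : HSpace) : ‖creation x f‖ = ‖f‖ := by
  have hsum : creation false f + creation true f =
      ((√2 : ℝ) : ℂ) • Lp.compMeasurePreservingₗᵢ ℂ shift measurePreserving_shift f := by
    refine Lp.ext ?_
    have h0 := Lp.coeFn_add (creation false f) (creation true f)
    have h1 := Lp.coeFn_smul ((√2 : ℝ) : ℂ)
      (Lp.compMeasurePreserving shift measurePreserving_shift f)
    have h4 := Lp.coeFn_compMeasurePreserving f measurePreserving_shift
    filter_upwards [h0, h1, h4, creation_apply false f, creation_apply true f]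
      with w h0 h1 h4 h5 h6
    rw [h0, Pi.add_apply, h5, h6]
    refine Eq.trans ?_ h1.symm
    rw [Pi.smul_apply, h4]
    cases w 0 <;> simp
  have hnorm : ‖creation false f‖ = ‖creation true f‖ := by
    have := stateOp_creation .a false f
    have h2 := norm_stateOp_apply .a (creation false f)
    rw [this] at h2
    rw [← h2]
    simp [State.out, State.step, stateOp_e]
  have h1 := norm_add_sq_eq_norm_sq_add_norm_sq_of_inner_eq_zero (𝕜 := ℂ) _ _
    (inner_creation_of_ne Bool.false_ne_true f f)
  rw [hsum, norm_smul, LinearIsometry.norm_map, Complex.norm_real, Real.norm_of_nonneg (by simp)]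
    at h1
  have h2 : √2 * √2 = (2 : ℝ) := Real.mul_self_sqrt (by norm_num)
  have h3 : ‖creation true f‖ * ‖creation true f‖ = ‖f‖ * ‖f‖ := by
    rw [hnorm] at h1
    linear_combination (-1 / 2 : ℝ) * h1 + 1 / 2 * ‖f‖ * ‖f‖ * h2
  have h4 : ‖creation true f‖ = ‖f‖ := by
    rwa [mul_self_inj (norm_nonneg _) (norm_nonneg _)] at h3
  cases x
  · rw [hnorm, h4]
  · exact h4

theorem adjoint_creation_comp_creation (y x : Bool) :
    (ContinuousLinearMap.adjoint (creation y)).comp (creation x) = if y = x then 1 else 0 := by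
  split_ifs with h
  · subst h
    exact (ContinuousLinearMap.norm_map_iff_adjoint_comp_self _).1 (norm_creation_apply y)
  · ext1 f
    refine ext_inner_left ℂ fun g => ?_
    rw [ContinuousLinearMap.comp_apply, ContinuousLinearMap.adjoint_inner_right,
      inner_creation_of_ne h]
    simp

theorem block_stateOp (g : State) (y x : Bool) :
    block (stateOp g) y x = if y = g.out x then stateOp (g.step x) else 0 := by
  have h : (stateOp g).comp (creation x) = (creation (g.out x)).comp (stateOp (g.step x)) :=
    ContinuousLinearMap.ext (stateOp_creation g x)
  rw [block, h, ← ContinuousLinearMap.comp_assoc, adjoint_creation_comp_creation]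
  split_ifs
  · exact one_mul _
  · exact ContinuousLinearMap.zero_comp _

theorem block_add (M N : HSpace →L[ℂ] HSpace) (y x : Bool) :
    block (M + N) y x = block M y x + block N y x := by
  ext1 f; simp [block]

theorem block_smul (t : ℂ) (M : HSpace →L[ℂ] HSpace) (y x : Bool) :
    block (t • M) y x = t • block M y x := by
  ext1 f; simp [block]

theorem block_one (y x : Bool) : block 1 y x = if y = x then 1 else 0 := by
  rw [← adjoint_creation_comp_creation]; rfl

/-- In the corner of the letter `0`, `b` and `c` both restrict to `a`, while `d` restricts to the
identity and cancels the `-1` in `S`. -/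
theorem block_rep_homPencil (l m w : ℝ) (y x : Bool) :
    block (rep (homPencil (l, m, w))) y x =
      if y = x then
        if x then (w : ℂ) • opS - (m : ℂ) • 1 else (2 * w : ℂ) • stateOp .a - (m : ℂ) • 1
      else -((l : ℂ) • 1) := by
  have h : rep (homPencil (l, m, w)) = (-l : ℂ) • stateOp .a + (w : ℂ) • stateOp .b +
      (w : ℂ) • stateOp .c + (w : ℂ) • stateOp .d + (-(m + w) : ℂ) • 1 := by
    rw [rep_homPencil, opS]; module
  rw [h]
  simp only [block_add, block_smul, block_stateOp, block_one]
  cases y <;> cases x <;> simp [State.out, State.step, stateOp_e, opS] <;> module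

/-- The generators extend themselves by the matrix recursion along the 2-similarity. -/
theorem isExtension_creation : IsExtension (stateOp .a : HSpace →ₗ[ℂ] HSpace) opS
    (stateOp .a : HSpace →ₗ[ℂ] HSpace) opS (fun x => creation x) where
  map_A x f := by
    have := stateOp_creation .a x f
    rwa [State.step, stateOp_e] at this
    all_goals simp
  map_S_false f := by
    simp [opS, stateOp_creation, State.out, State.step, stateOp_e]
    module
  map_S_true f := by
    simp [opS, stateOp_creation, State.out, State.step]
    abel
  eq_zero f g h := by
    have h1 := norm_add_sq_eq_norm_sq_add_norm_sq_of_inner_eq_zero (𝕜 := ℂ) _ _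
      (inner_creation_of_ne Bool.false_ne_true f g)
    have h' : creation false f + creation true g = 0 := h
    rw [h', norm_zero, norm_creation_apply, norm_creation_apply] at h1
    have h2 : ‖f‖ = 0 := by nlinarith [norm_nonneg f, norm_nonneg g]
    have h3 : ‖g‖ = 0 := by nlinarith [norm_nonneg f, norm_nonneg g]
    exact ⟨norm_eq_zero.1 h2, norm_eq_zero.1 h3⟩

theorem stateOp_a_apply_self (f : HSpace) :
    (stateOp .a : HSpace →ₗ[ℂ] HSpace) ((stateOp .a : HSpace →ₗ[ℂ] HSpace) f) = f :=
  DFunLike.congr_fun (stateOp_mul_self .a) f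

theorem opS_apply_self (f : HSpace) :
    (opS : HSpace →ₗ[ℂ] HSpace) ((opS : HSpace →ₗ[ℂ] HSpace) f) = (4 : ℂ) • f :=
  DFunLike.congr_fun opS_mul_self f

/-! ### Explicit joint eigenvectors -/

theorem exists_fixed : ∃ v : HSpace, v ≠ 0 ∧ stateOp .a v = v ∧ opS v = (2 : ℂ) • v := by
  have h : ∀ g, stateOp g (Lp.const 2 bernoulli (1 : ℂ)) = Lp.const 2 bernoulli (1 : ℂ) := by
    intro g
    refine Lp.ext ?_
    have h0 := Lp.coeFn_const (p := 2) (μ := bernoulli) (1 : ℂ)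
    refine (stateOp_apply g _).trans ?_
    refine ((measurePreserving_act g).quasiMeasurePreserving.ae_eq_comp h0).trans ?_
    exact h0.symm
  refine ⟨Lp.const 2 bernoulli (1 : ℂ), ?_, h _, ?_⟩
  · have hn := Lp.norm_const' (p := 2) (μ := bernoulli) (c := (1 : ℂ)) (by norm_num) (by simp)
    rw [← norm_ne_zero_iff]
    refine ne_of_eq_of_ne hn ?_
    simp
  · simp [opS, h]
    module

theorem exists_antifixed : ∃ v : HSpace, v ≠ 0 ∧ stateOp .a v = -v ∧ opS v = (2 : ℂ) • v :=
  isExtension_creation.exists_antifixed exists_fixed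

/-- On functions supported on words starting with `0`, `S` acts as `2A`, and `A` has the eigenvalue
`-1`. Together with the eigenvalue `2` this makes the invertibility condition for the diagonal
blocks sharp. -/
theorem exists_opS_eq_neg : ∃ v : HSpace, v ≠ 0 ∧ opS v = (-2 : ℂ) • v := by
  obtain ⟨v, hv, hA, -⟩ := exists_antifixed
  refine ⟨creation false v, ?_, ?_⟩
  · have := isExtension_creation.ne_zero hv 0
    rwa [map_zero, add_zero] at this
  · refine (isExtension_creation.map_S_false v).trans ?_
    simp [hA]

theorem not_isUnit_of_apply_eq_zero {M : HSpace →L[ℂ] HSpace} {v : HSpace} (hv : v ≠ 0)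
    (h : M v = 0) : ¬ IsUnit M := by
  rintro ⟨u, rfl⟩
  apply hv
  have := DFunLike.congr_fun u.inv_mul v
  rw [mul_apply_eq_comp, h, map_zero] at this
  exact this.symm

/-! ### Schur complements -/

section Inverse

variable {R : Type*} [Ring R] [Algebra ℂ R] {E : R}

theorem sub_mul_add_of_sq (hE : E * E = (4 : ℂ) • 1) (w m : ℂ) :
    (w • E - m • 1) * (w • E + m • 1) = (4 * w ^ 2 - m ^ 2) • 1 ∧
      (w • E + m • 1) * (w • E - m • 1) = (4 * w ^ 2 - m ^ 2) • 1 := by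
  constructor <;>
  · simp only [mul_add, add_mul, mul_sub, sub_mul, smul_mul_assoc, mul_smul_comm, hE, mul_one,
      one_mul]
    module

theorem isUnit_and_inverse_of_sq (hE : E * E = (4 : ℂ) • 1) {w m : ℂ}
    (h : 4 * w ^ 2 - m ^ 2 ≠ 0) :
    IsUnit (w • E - m • 1) ∧
      Ring.inverse (w • E - m • 1) = (4 * w ^ 2 - m ^ 2)⁻¹ • (w • E + m • 1) := by
  let u : Rˣ := ⟨w • E - m • 1, (4 * w ^ 2 - m ^ 2)⁻¹ • (w • E + m • 1),
    by rw [mul_smul_comm, (sub_mul_add_of_sq hE w m).1, inv_smul_smul₀ h],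
    by rw [smul_mul_assoc, (sub_mul_add_of_sq hE w m).2, inv_smul_smul₀ h]⟩
  exact ⟨⟨u, rfl⟩, Ring.inverse_unit u⟩

end Inverse

theorem ofReal_sub_ne_zero {m w : ℝ} (h : m ^ 2 ≠ 4 * w ^ 2) :
    4 * (w : ℂ) ^ 2 - (m : ℂ) ^ 2 ≠ 0 := by
  intro h0
  apply h
  have : ((4 * w ^ 2 - m ^ 2 : ℝ) : ℂ) = 0 := by push_cast; exact h0
  have := Complex.ofReal_eq_zero.1 this
  linarith

theorem isUnit_smul_sub_iff {E : HSpace →L[ℂ] HSpace} (hE : E * E = (4 : ℂ) • 1)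
    (h₁ : ∃ v : HSpace, v ≠ 0 ∧ E v = (2 : ℂ) • v)
    (h₂ : ∃ v : HSpace, v ≠ 0 ∧ E v = (-2 : ℂ) • v) (w m : ℝ) :
    IsUnit ((w : ℂ) • E - (m : ℂ) • 1) ↔ m ^ 2 ≠ 4 * w ^ 2 := by
  constructor
  · intro hu hm
    have hm' : (m - 2 * w) * (m + 2 * w) = 0 := by linear_combination hm
    rcases mul_eq_zero.1 hm' with h | h
    · obtain ⟨v, hv, hEv⟩ := h₁
      refine not_isUnit_of_apply_eq_zero hv ?_ hu
      obtain rfl : m = 2 * w := by linarith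
      change (w : ℂ) • E v - ((2 * w : ℝ) : ℂ) • v = 0
      rw [hEv]
      push_cast
      module
    · obtain ⟨v, hv, hEv⟩ := h₂
      refine not_isUnit_of_apply_eq_zero hv ?_ hu
      obtain rfl : m = -(2 * w) := by linarith
      change (w : ℂ) • E v - ((-(2 * w) : ℝ) : ℂ) • v = 0
      rw [hEv]
      push_cast
      module
  · intro h
    exact (isUnit_and_inverse_of_sq hE (ofReal_sub_ne_zero h)).1

theorem two_stateOp_a_mul_self :
    ((2 : ℂ) • stateOp .a) * ((2 : ℂ) • stateOp .a) = (4 : ℂ) • 1 := by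
  rw [smul_mul_smul_comm, stateOp_mul_self]
  norm_num

theorem isUnit_block_true_iff (l m w : ℝ) :
    IsUnit (block (rep (homPencil (l, m, w))) true true) ↔ m ^ 2 ≠ 4 * w ^ 2 := by
  rw [block_rep_homPencil, if_pos rfl, if_pos rfl]
  obtain ⟨v, hv, -, h⟩ := exists_fixed
  exact isUnit_smul_sub_iff opS_mul_self ⟨v, hv, h⟩ exists_opS_eq_neg w m

theorem isUnit_block_false_iff (l m w : ℝ) :
    IsUnit (block (rep (homPencil (l, m, w))) false false) ↔ m ^ 2 ≠ 4 * w ^ 2 := by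
  rw [block_rep_homPencil, if_pos rfl, if_neg Bool.false_ne_true, mul_comm, mul_smul]
  obtain ⟨v, hv, h, -⟩ := exists_fixed
  obtain ⟨v', hv', h', -⟩ := exists_antifixed
  exact isUnit_smul_sub_iff two_stateOp_a_mul_self ⟨v, hv, by simp [h]⟩ ⟨v', hv', by simp [h']⟩ w m

theorem sameClass_schur₁ {l m w : ℝ} (h : m ^ 2 ≠ 4 * w ^ 2) :
    SameClass (schur₁ (rep (homPencil (l, m, w)))) (rep (homPencil (homF (l, m, w)))) := by
  have hk := ofReal_sub_ne_zero h
  -- The complement is `2wA - m - l² (wS + m) / (4w² - m²)`; clearing the denominator with a minus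
  -- sign makes the coefficient of `S` equal to `w l²`.
  refine ⟨-(4 * (w : ℂ) ^ 2 - (m : ℂ) ^ 2)⁻¹, neg_ne_zero.2 (inv_ne_zero hk), ?_⟩
  simp only [schur₁, block_rep_homPencil]
  simp only [homF, rep_homPencil]
  simp only [if_true, if_false, Bool.false_eq_true, reduceCtorEq,
    (isUnit_and_inverse_of_sq opS_mul_self hk).2, neg_mul, mul_neg, smul_mul_assoc,
    mul_smul_comm, one_mul, mul_one]
  push_cast
  match_scalars <;>
    first
    | (field_simp; ring1)
    | ring1
    | linear_combination (-w : ℂ) * mul_inv_cancel₀ hk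
    | linear_combination (-2 * w : ℂ) * mul_inv_cancel₀ hk

theorem sameClass_schur₂ {l m w : ℝ} (h : m ^ 2 ≠ 4 * w ^ 2) :
    SameClass (schur₂ (rep (homPencil (l, m, w)))) (rep (homPencil (homG (l, m, w)))) := by
  have hk := ofReal_sub_ne_zero h
  refine ⟨(4 * (w : ℂ) ^ 2 - (m : ℂ) ^ 2)⁻¹, inv_ne_zero hk, ?_⟩
  simp only [schur₂, block_rep_homPencil]
  simp only [homG, rep_homPencil]
  -- The operator with square `4` in this corner is `2A`.
  have e : (2 * w : ℂ) • stateOp .a - (m : ℂ) • 1 =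
      (w : ℂ) • ((2 : ℂ) • stateOp .a) - (m : ℂ) • 1 := by module
  simp only [if_true, if_false, Bool.false_eq_true, reduceCtorEq, e,
    (isUnit_and_inverse_of_sq two_stateOp_a_mul_self hk).2, neg_mul, mul_neg, smul_mul_assoc,
    mul_smul_comm, one_mul, mul_one]
  push_cast
  match_scalars <;>
    first
    | (field_simp; ring1)
    | ring1
    | linear_combination (-w : ℂ) * mul_inv_cancel₀ hk

theorem rep_homPencil_smul (t : ℝ) (v : ℝ × ℝ × ℝ) :
    rep (homPencil (t • v)) = (t : ℂ) • rep (homPencil v) := by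
  obtain ⟨l, m, w⟩ := v
  simp only [Prod.smul_mk, rep_homPencil, smul_eq_mul]
  push_cast
  module

theorem SameClass.smul_right {M N : HSpace →L[ℂ] HSpace} {t : ℝ} (ht : t ≠ 0)
    (h : SameClass M ((t : ℂ) • N)) : SameClass M N := by
  obtain ⟨s, hs, rfl⟩ := h
  exact ⟨s * t, mul_ne_zero hs (Complex.ofReal_ne_zero.2 ht), smul_smul _ _ _⟩

theorem sameClass_schur₁_pencil {lam mu : ℝ} (hmu : mu ^ 2 ≠ 4) (hlam : lam ≠ 0) :
    SameClass (schur₁ (rep (pencil lam mu)))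
      (rep (pencil (F (lam, mu)).1 (F (lam, mu)).2)) := by
  have h := sameClass_schur₁ (l := lam) (m := mu) (w := 1) (by simpa using hmu)
  rw [homF_affine (lam, mu) hlam, rep_homPencil_smul, homPencil_affine, homPencil_affine] at h
  exact h.smul_right (pow_ne_zero 2 hlam)

theorem sameClass_schur₂_pencil {lam mu : ℝ} (hmu : mu ^ 2 ≠ 4) :
    SameClass (schur₂ (rep (pencil lam mu)))
      (rep (pencil (G (lam, mu)).1 (G (lam, mu)).2)) := by
  have h := sameClass_schur₂ (l := lam) (m := mu) (w := 1) (by simpa using hmu)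
  rw [homG_affine (lam, mu) hmu, rep_homPencil_smul, homPencil_affine, homPencil_affine] at h
  exact h.smul_right fun h0 => hmu (by dsimp only at h0; linarith)

/-! ### The spectrum of the pencil -/

/-! ### Norm bounds and invertibility outside the spectrum -/

theorem norm_stateOp_le (g : State) : ‖stateOp g‖ ≤ 1 :=
  ContinuousLinearMap.opNorm_le_bound _ zero_le_one fun f => by
    rw [norm_stateOp_apply, one_mul]

theorem norm_opS_le : ‖opS‖ ≤ 2 := by
  have h := ContinuousLinearMap.norm_adjoint_comp_self opS
  have h0 : (ContinuousLinearMap.adjoint opS).comp opS = (4 : ℂ) • 1 := by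
    rw [isSelfAdjoint_opS.adjoint_eq]
    exact opS_mul_self
  rw [h0, norm_smul] at h
  have h1 : ‖(1 : HSpace →L[ℂ] HSpace)‖ ≤ 1 := ContinuousLinearMap.norm_id_le
  have h4 : ‖(4 : ℂ)‖ = 4 := by norm_num
  rw [h4] at h
  nlinarith [norm_nonneg opS]

theorem norm_anticommutator_le :
    ‖stateOp .a * opS + opS * stateOp .a‖ ≤ 4 := by
  have h1 : ‖stateOp .a * opS‖ ≤ 1 * 2 :=
    (norm_mul_le _ _).trans (mul_le_mul (norm_stateOp_le _) norm_opS_le (norm_nonneg _) zero_le_one)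
  have h2 : ‖opS * stateOp .a‖ ≤ 2 * 1 :=
    (norm_mul_le _ _).trans (mul_le_mul norm_opS_le (norm_stateOp_le _) (norm_nonneg _) zero_le_two)
  linarith [norm_add_le (stateOp .a * opS) (opS * stateOp .a)]

/-- The pencils at `m` and `-m` commute with product `t - l Q`, `t = 4 - m² + l²`; this is
invertible by a Neumann series because `|l| ‖Q‖ < |t|`, so both factors are. -/
theorem isUnit_rep_pencil {l m : ℝ} (h : 4 * |l| < |4 - m ^ 2 + l ^ 2|) :
    IsUnit (rep (pencil l m)) := by
  set t : ℝ := 4 - m ^ 2 + l ^ 2 with ht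
  set Q := stateOp .a * opS + opS * stateOp .a with hQ
  have ht0 : t ≠ 0 := by
    rw [← abs_pos]
    linarith [abs_nonneg l]
  have ht0' : (t : ℂ) ≠ 0 := Complex.ofReal_ne_zero.2 ht0
  have hu : IsUnit (1 - ((l / t : ℝ) : ℂ) • Q) := by
    refine isUnit_one_sub_of_norm_lt_one ?_
    rw [norm_smul, Complex.norm_real, Real.norm_eq_abs, abs_div]
    calc |l| / |t| * ‖Q‖ ≤ |l| / |t| * 4 :=
          mul_le_mul_of_nonneg_left norm_anticommutator_le (by positivity)
      _ = 4 * |l| / |t| := by ring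
      _ < 1 := (div_lt_one (abs_pos.2 ht0)).2 h
  have hu2 : IsUnit ((t : ℂ) • (1 - ((l / t : ℝ) : ℂ) • Q)) :=
    hu.smul (Units.mk0 _ ht0')
  have e : (t : ℂ) • (1 - ((l / t : ℝ) : ℂ) • Q) = (t : ℂ) • 1 - (l : ℂ) • Q := by
    rw [smul_sub, smul_smul, ← Complex.ofReal_mul, mul_div_cancel₀ _ ht0]
  have hprod : ∀ s : ℂ, s ^ 2 = m ^ 2 →
      (-((l : ℂ) • stateOp .a) + opS - s • 1) * (-((l : ℂ) • stateOp .a) + opS + s • 1) =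
        (t : ℂ) • 1 - (l : ℂ) • Q := by
    intro s hs
    simp only [mul_add, add_mul, sub_mul, smul_mul_assoc, mul_smul_comm, neg_mul, mul_neg,
      opS_mul_self, stateOp_mul_self, mul_one, one_mul, hQ, ht, Complex.ofReal_add,
      Complex.ofReal_sub, Complex.ofReal_pow, ← hs]
    push_cast
    module
  have h1 := hprod m rfl
  have h2 := hprod (-m) (by ring)
  simp only [neg_smul, sub_neg_eq_add, ← sub_eq_add_neg] at h2
  have hc : Commute (-((l : ℂ) • stateOp .a) + opS - (m : ℂ) • 1)
      (-((l : ℂ) • stateOp .a) + opS + (m : ℂ) • 1) := h1.trans h2.symm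
  rw [rep_pencil]
  refine (hc.isUnit_mul_iff.1 ?_).1
  rw [h1, ← e]
  exact hu2

/-! ### The backward orbit of zero and the hyperbolas in the spectrum -/

theorem coe_alpha (θ : Set.Icc (-1 : ℝ) 1) : (alpha θ : ℝ) = 2 * (θ : ℝ) ^ 2 - 1 := rfl

/-- The endpoints `±1` are mapped to the fixed point `1`, so they never reach `0`; this keeps the
degenerate eigenvalues `±4` out. -/
theorem sq_ne_one_of_iterate_alpha {i : ℕ} {θ : Set.Icc (-1 : ℝ) 1}
    (h : ((alpha^[i] θ : Set.Icc (-1 : ℝ) 1) : ℝ) = 0) : (θ : ℝ) ^ 2 ≠ 1 := by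
  induction i generalizing θ with
  | zero =>
    have h' : (θ : ℝ) = 0 := h
    rw [h']; norm_num
  | succ i ih =>
    rw [Function.iterate_succ_apply] at h
    intro h1
    apply ih h
    rw [coe_alpha, h1]; norm_num

/-- Needed for a sign convention: the hyperbola of `θ` belongs to the eigenvalue `-4θ` of `Q`. It
holds because `α` is even. -/
theorem exists_neg_iterate_alpha {i : ℕ} {θ : Set.Icc (-1 : ℝ) 1}
    (h : ((alpha^[i] θ : Set.Icc (-1 : ℝ) 1) : ℝ) = 0) :
    ∃ θ' : Set.Icc (-1 : ℝ) 1, (θ' : ℝ) = -θ ∧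
      ((alpha^[i] θ' : Set.Icc (-1 : ℝ) 1) : ℝ) = 0 := by
  refine ⟨⟨-θ, by linarith [θ.2.2], by linarith [θ.2.1]⟩, rfl, ?_⟩
  cases i with
  | zero =>
    have h' : (θ : ℝ) = 0 := h
    simp [h']
  | succ i =>
    have e : alpha ⟨-θ, by linarith [θ.2.2], by linarith [θ.2.1]⟩ = alpha θ :=
      Subtype.ext (by simp [coe_alpha])
    rwa [Function.iterate_succ_apply, e]

theorem exists_eigenvector_of_iterate {i : ℕ} {θ : Set.Icc (-1 : ℝ) 1}
    (h : ((alpha^[i] θ : Set.Icc (-1 : ℝ) 1) : ℝ) = 0) :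
    ∃ v : HSpace, v ≠ 0 ∧ stateOp .a (opS v) + opS (stateOp .a v) = (4 * ((θ : ℝ) : ℂ)) • v := by
  have hzero := isExtension_creation.exists_eigenvector_zero exists_antifixed
  induction i generalizing θ with
  | zero =>
    have h' : (θ : ℝ) = 0 := h
    rw [h', Complex.ofReal_zero]
    exact hzero
  | succ i ih =>
    by_cases h0 : (θ : ℝ) = 0
    · rw [h0, Complex.ofReal_zero]
      exact hzero
    · refine isExtension_creation.exists_eigenvector stateOp_a_apply_self opS_apply_self
        (Complex.ofReal_ne_zero.2 h0) ?_
      have := ih (θ := alpha θ) h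
      rw [coe_alpha] at this
      push_cast at this
      exact this

theorem hyperbola_subset_SigmaSet_of_iterate {i : ℕ} {θ : Set.Icc (-1 : ℝ) 1}
    (h : ((alpha^[i] θ : Set.Icc (-1 : ℝ) 1) : ℝ) = 0) : hyperbola θ ⊆ SigmaSet := by
  rintro ⟨l, m⟩ hp
  have hp' : 4 - m ^ 2 + l ^ 2 + 4 * l * (θ : ℝ) = 0 := hp
  obtain ⟨θ', hθ', h'⟩ := exists_neg_iterate_alpha h
  obtain ⟨v, hv, hQ⟩ := exists_eigenvector_of_iterate h'
  have hc : (((θ' : ℝ) : ℂ)) ^ 2 ≠ 1 := by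
    exact_mod_cast sq_ne_one_of_iterate_alpha h'
  have hlm : 4 - (m : ℂ) ^ 2 + (l : ℂ) ^ 2 = 4 * l * ((θ' : ℝ) : ℂ) := by
    rw [hθ']
    exact_mod_cast (by linarith : 4 - m ^ 2 + l ^ 2 = 4 * l * -(θ : ℝ))
  obtain ⟨w, hw, hker⟩ := exists_kernel_of_eigenvector stateOp_a_apply_self opS_apply_self hc hlm
    hv hQ
  refine not_isUnit_of_apply_eq_zero hw ?_
  rw [rep_pencil]
  exact hker

theorem isClosed_SigmaSet : IsClosed SigmaSet := by
  have hcont : Continuous fun p : ℝ × ℝ => rep (pencil p.1 p.2) := by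
    simp only [rep_pencil]
    fun_prop
  exact nonunits.isClosed.preimage hcont

theorem iterate_alpha_cos (i : ℕ) (t : ℝ) :
    ((alpha^[i] ⟨Real.cos t, Real.neg_one_le_cos t, Real.cos_le_one t⟩ :
      Set.Icc (-1 : ℝ) 1) : ℝ) = Real.cos (2 ^ i * t) := by
  induction i generalizing t with
  | zero => simp
  | succ i ih =>
    have h : alpha ⟨Real.cos t, Real.neg_one_le_cos t, Real.cos_le_one t⟩ =
        ⟨Real.cos (2 * t), Real.neg_one_le_cos _, Real.cos_le_one _⟩ :=
      Subtype.ext (Real.cos_two_mul t).symm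
    rw [Function.iterate_succ_apply, h, ih]
    ring_nf

/-- The zeros for a given `i` form an arithmetic progression with step `π / 2 ^ i`; rounding picks
the one nearest to `t`. -/
theorem dense_cos_two_pow_mul_eq_zero : Dense {t : ℝ | ∃ i : ℕ, Real.cos (2 ^ i * t) = 0} := by
  rw [Metric.dense_iff]
  intro t r hr
  obtain ⟨i, hi⟩ := pow_unbounded_of_one_lt (Real.pi / r) one_lt_two
  have h2 : (0 : ℝ) < 2 ^ i := by positivity
  set z : ℤ := round (2 ^ i * t / Real.pi - 1 / 2) with hz
  have hr' : Real.pi < 2 ^ i * r := (div_lt_iff₀ hr).1 hi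
  refine ⟨(2 * z + 1) * Real.pi / 2 / 2 ^ i, ?_, i, ?_⟩
  · rw [Metric.mem_ball, dist_comm, Real.dist_eq]
    have h1 := abs_sub_round (2 ^ i * t / Real.pi - 1 / 2)
    rw [← hz] at h1
    have e : t - (2 * z + 1) * Real.pi / 2 / 2 ^ i =
        (2 ^ i * t / Real.pi - 1 / 2 - z) * (Real.pi / 2 ^ i) := by
      field_simp
      ring
    rw [e, abs_mul, abs_of_pos (by positivity : 0 < Real.pi / 2 ^ i)]
    calc _ ≤ 1 / 2 * (Real.pi / 2 ^ i) := mul_le_mul_of_nonneg_right h1 (by positivity)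
      _ < r := by
        rw [← mul_div_assoc, div_lt_iff₀ h2]
        linarith [Real.pi_pos]
  · rw [mul_div_cancel₀ _ h2.ne', Real.cos_eq_zero_iff]
    exact ⟨z, rfl⟩

theorem Icc_subset_closure_iterate_alpha : Set.Icc (-1 : ℝ) 1 ⊆
    closure {x : ℝ | ∃ (θ : Set.Icc (-1 : ℝ) 1) (i : ℕ), (θ : ℝ) = x ∧
      ((alpha^[i] θ : Set.Icc (-1 : ℝ) 1) : ℝ) = 0} := by
  intro x hx
  have h1 : x ∈ Real.cos '' closure {t : ℝ | ∃ i : ℕ, Real.cos (2 ^ i * t) = 0} := by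
    rw [dense_cos_two_pow_mul_eq_zero.closure_eq]
    exact ⟨Real.arccos x, trivial, Real.cos_arccos hx.1 hx.2⟩
  refine closure_mono ?_ (image_closure_subset_closure_image Real.continuous_cos h1)
  rintro _ ⟨t, ⟨i, hi⟩, rfl⟩
  exact ⟨_, i, rfl, (iterate_alpha_cos i t).trans hi⟩

theorem hyperbola_subset_SigmaSet {θ : ℝ} (hθ : θ ∈ Set.Icc (-1 : ℝ) 1) :
    hyperbola θ ⊆ SigmaSet := by
  rintro ⟨l, m⟩ hp
  have hp' : 4 - m ^ 2 + l ^ 2 + 4 * l * θ = 0 := hp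
  obtain ⟨s, hs, hsm⟩ : ∃ s : ℝ, s ^ 2 = 1 ∧ s * √(m ^ 2) = m := by
    rw [Real.sqrt_sq_eq_abs]
    rcases abs_cases m with ⟨h, -⟩ | ⟨h, -⟩ <;> rw [h]
    · exact ⟨1, by norm_num, by ring⟩
    · exact ⟨-1, by norm_num, by ring⟩
  -- With `l` and the sign of `m` fixed, this curve meets the hyperbola of each `x ∈ [-1, 1]`, so
  -- density of the good parameters suffices.
  have hcl : IsClosed {x : ℝ | (l, s * √(4 + l ^ 2 + 4 * l * x)) ∈ SigmaSet} :=
    isClosed_SigmaSet.preimage (by fun_prop)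
  have hmem := closure_minimal ?_ hcl (Icc_subset_closure_iterate_alpha hθ)
  · have e : 4 + l ^ 2 + 4 * l * θ = m ^ 2 := by linarith
    simpa [e, hsm] using hmem
  · rintro x ⟨θ', i, rfl, hi⟩
    refine hyperbola_subset_SigmaSet_of_iterate hi ?_
    -- This is the convex combination of `(l + 2)²` and `(l - 2)²` with weights `(1 ± θ') / 2`.
    have hnn : 0 ≤ 4 + l ^ 2 + 4 * l * (θ' : ℝ) := by
      nlinarith [mul_nonneg (sub_nonneg.2 θ'.2.1) (sq_nonneg (l + 2)),
        mul_nonneg (sub_nonneg.2 θ'.2.2) (sq_nonneg (l - 2)), sq_nonneg (l + 2 * (θ' : ℝ)),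
        θ'.2.1, θ'.2.2]
    change 4 - (s * √(4 + l ^ 2 + 4 * l * (θ' : ℝ))) ^ 2 + l ^ 2 + 4 * l * (θ' : ℝ) = 0
    rw [mul_pow, hs, Real.sq_sqrt hnn]
    ring

theorem mem_SigmaSet_iff (p : ℝ × ℝ) :
    p ∈ SigmaSet ↔ (4 - p.2 ^ 2 + p.1 ^ 2) ^ 2 ≤ (4 * p.1) ^ 2 := by
  obtain ⟨l, m⟩ := p
  rw [sq_le_sq, abs_mul, abs_of_pos (by norm_num : (0 : ℝ) < 4)]
  constructor
  · intro hp
    by_contra hlt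
    exact hp (isUnit_rep_pencil (not_le.1 hlt))
  · intro hle
    dsimp only at hle
    by_cases hl : l = 0
    · subst hl
      refine hyperbola_subset_SigmaSet (θ := 0) (by norm_num) ?_
      rw [abs_zero, mul_zero, abs_nonpos_iff] at hle
      change 4 - m ^ 2 + 0 ^ 2 + 4 * 0 * 0 = (0 : ℝ)
      linarith
    · have hl' : 0 < 4 * |l| := by positivity
      refine hyperbola_subset_SigmaSet (θ := -(4 - m ^ 2 + l ^ 2) / (4 * l)) ?_ ?_
      · rw [Set.mem_Icc, ← abs_le, abs_div, abs_neg, abs_mul,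
          abs_of_pos (by norm_num : (0 : ℝ) < 4), div_le_one hl']
        exact hle
      · change 4 - m ^ 2 + l ^ 2 + 4 * l * (-(4 - m ^ 2 + l ^ 2) / (4 * l)) = 0
        field_simp
        ring

theorem SigmaSet_eq : SigmaSet = {p | |(|p.1| - 2)| ≤ |p.2| ∧ |p.2| ≤ |p.1| + 2} := by
  ext ⟨l, m⟩
  rw [mem_SigmaSet_iff, sq_le_sq, abs_mul, abs_of_pos (by norm_num : (0 : ℝ) < 4), abs_le]
  have h1 : |(|l| - 2)| ≤ |m| ↔ (|l| - 2) ^ 2 ≤ m ^ 2 := sq_le_sq.symm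
  have h2 : |m| ≤ |l| + 2 ↔ m ^ 2 ≤ (|l| + 2) ^ 2 := by
    rw [sq_le_sq, abs_of_nonneg (by positivity : 0 ≤ |l| + 2)]
  change _ ↔ |(|l| - 2)| ≤ |m| ∧ |m| ≤ |l| + 2
  rw [h1, h2, ← sq_abs l]
  dsimp only
  constructor <;> rintro ⟨h, h'⟩ <;> constructor <;> linarith

/-! ### Invariance of the full spectrum -/

theorem G_mem_SigmaSet_iff {p : ℝ × ℝ} (hp : p ∈ schurDomain) :
    G p ∈ SigmaSet ↔ p ∈ SigmaSet := by
  obtain ⟨l, m⟩ := p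
  have hm : m ^ 2 ≠ 4 := hp
  have hk : 4 - m ^ 2 ≠ 0 := fun h => hm (by linarith)
  rw [mem_SigmaSet_iff, mem_SigmaSet_iff, ← sub_nonpos, ← sub_nonpos (b := (4 * l) ^ 2)]
  -- The defining polynomial is multiplied by a square under `G`. Where that square vanishes, the
  -- polynomial at `(l, m)` is `-16 l² ≤ 0`, so nothing is lost.
  have e : (4 - (G (l, m)).2 ^ 2 + (G (l, m)).1 ^ 2) ^ 2 - (4 * (G (l, m)).1) ^ 2 =
      ((4 - m ^ 2 + l ^ 2) / (4 - m ^ 2)) ^ 2 * ((4 - m ^ 2 + l ^ 2) ^ 2 - (4 * l) ^ 2) := by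
    simp only [G]
    field_simp
    ring
  rw [e]
  constructor
  · intro h
    by_contra hlt
    rw [not_le] at hlt
    have h0 : ((4 - m ^ 2 + l ^ 2) / (4 - m ^ 2)) ^ 2 = 0 :=
      le_antisymm (nonpos_of_mul_nonpos_left h hlt) (sq_nonneg _)
    have h0' : 4 - m ^ 2 + l ^ 2 = 0 := by simpa [hk] using h0
    rw [h0'] at hlt
    nlinarith [sq_nonneg l]
  · exact fun h => mul_nonpos_of_nonneg_of_nonpos (sq_nonneg _) h

/-- `F` is `G` followed by `(l, m) ↦ (4 / l, -2 m / l)`, which multiplies the defining polynomial by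
`(2 / l)⁴`. -/
theorem F_mem_SigmaSet_iff {p : ℝ × ℝ} (hp : p ∈ schurDomain) (hl : p.1 ≠ 0) :
    F p ∈ SigmaSet ↔ G p ∈ SigmaSet := by
  obtain ⟨l, m⟩ := p
  have hm : m ^ 2 ≠ 4 := hp
  have hl' : l ≠ 0 := hl
  have hk : 4 - m ^ 2 ≠ 0 := fun h => hm (by linarith)
  rw [mem_SigmaSet_iff, mem_SigmaSet_iff, ← sub_nonpos, ← sub_nonpos (b := (4 * (G (l, m)).1) ^ 2)]
  have e : (4 - (F (l, m)).2 ^ 2 + (F (l, m)).1 ^ 2) ^ 2 - (4 * (F (l, m)).1) ^ 2 =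
      ((4 - m ^ 2) / l ^ 2) ^ 4 *
        ((4 - (G (l, m)).2 ^ 2 + (G (l, m)).1 ^ 2) ^ 2 - (4 * (G (l, m)).1) ^ 2) := by
    simp only [F, G]
    field_simp
    ring
  have hpos : 0 < ((4 - m ^ 2) / l ^ 2) ^ 4 := by positivity
  rw [e]
  exact mul_nonpos_iff_pos_imp_nonpos.trans
    ⟨fun h => h.1 hpos, fun h => ⟨fun _ => h, fun _ => hpos.le⟩⟩

theorem ne_zero_of_mem_SigmaSet {p : ℝ × ℝ} (hp : p ∈ schurDomain) (h : p ∈ SigmaSet) :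
    p.1 ≠ 0 := by
  intro h0
  rw [mem_SigmaSet_iff, h0] at h
  apply hp
  nlinarith [sq_nonneg (4 - p.2 ^ 2)]

theorem SigmaSet_inter_eq_F :
    SigmaSet ∩ schurDomain = {p | p ∈ schurDomain ∧ p.1 ≠ 0 ∧ F p ∈ SigmaSet} := by
  ext p
  constructor
  · rintro ⟨h, hU⟩
    have h0 := ne_zero_of_mem_SigmaSet hU h
    exact ⟨hU, h0, (F_mem_SigmaSet_iff hU h0).2 ((G_mem_SigmaSet_iff hU).2 h)⟩
  · rintro ⟨hU, h0, h⟩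
    exact ⟨(G_mem_SigmaSet_iff hU).1 ((F_mem_SigmaSet_iff hU h0).1 h), hU⟩

theorem SigmaSet_inter_eq_G :
    SigmaSet ∩ schurDomain = {p | p ∈ schurDomain ∧ G p ∈ SigmaSet} := by
  ext p
  constructor
  · rintro ⟨h, hU⟩
    exact ⟨hU, (G_mem_SigmaSet_iff hU).2 h⟩
  · rintro ⟨hU, h⟩
    exact ⟨(G_mem_SigmaSet_iff hU).1 h, hU⟩

/-! ### The levels -/

/-- The functions on the words of length `n`. -/
abbrev LevelSpace (n : ℕ) : Type := (Fin n → Bool) → ℂ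

/-- The operator of the generator `a` on level `n`. -/
def levelA (n : ℕ) : LevelSpace n →ₗ[ℂ] LevelSpace n := (levelMatrix n .a).mulVecLin

/-- The operator of `b + c + d - 1` on level `n`. -/
def levelS (n : ℕ) : LevelSpace n →ₗ[ℂ] LevelSpace n :=
  (levelMatrix n .b + levelMatrix n .c + levelMatrix n .d - 1).mulVecLin

/-- The extension by zero of a function on the words `x w`, with `w` of length `n`. -/
def levelCreation (n : ℕ) (x : Bool) : LevelSpace n →ₗ[ℂ] LevelSpace (n + 1) where
  toFun f := fun w => if w 0 = x then f (Fin.tail w) else 0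
  map_add' f g := by funext w; by_cases h : w 0 = x <;> simp [h]
  map_smul' t f := by funext w; by_cases h : w 0 = x <;> simp [h]

theorem levelCreation_apply (n : ℕ) (x : Bool) (f : LevelSpace n) (w : Fin (n + 1) → Bool) :
    levelCreation n x f w = if w 0 = x then f (Fin.tail w) else 0 := rfl

theorem levelMatrix_mulVec_levelCreation (n : ℕ) (g : State) (x : Bool) (f : LevelSpace n) :
    (levelMatrix (n + 1) g).mulVec (levelCreation n x f) =
      levelCreation n (g.out x) ((levelMatrix n (g.step x)).mulVec f) := by
  funext v
  rw [levelCreation_apply, Matrix.mulVec, dotProduct,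
    ← (Fin.consEquiv fun _ : Fin (n + 1) => Bool).sum_comp, Fintype.sum_prod_type,
    Finset.sum_eq_single x]
  · simp only [Fin.consEquiv_apply, levelMatrix, Matrix.of_apply, levelCreation_apply, Fin.cons_zero,
      if_true, eq_comm (a := g.out x)]
    split_ifs
    · rfl
    · simp
  · intro y _ hy
    refine Finset.sum_eq_zero fun u _ => ?_
    simp [levelCreation_apply, hy]
  · simp

theorem levelMatrix_e (n : ℕ) : levelMatrix n .e = 1 := by
  induction n with
  | zero => rfl
  | succ n ih =>
    ext v u
    rw [levelMatrix, Matrix.of_apply]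
    simp only [State.out, State.step, ih, Matrix.one_apply]
    by_cases h : u 0 = v 0
    · rw [if_pos h]
      refine if_congr ?_ rfl rfl
      constructor
      · intro ht
        rw [← Fin.cons_self_tail v, ← Fin.cons_self_tail u, h, ht]
      · rintro rfl; rfl
    · rw [if_neg h, if_neg fun hvu => h (by rw [hvu])]

theorem exists_eq_levelCreation_add (n : ℕ) (f : LevelSpace (n + 1)) :
    ∃ f₀ f₁, f = levelCreation n false f₀ + levelCreation n true f₁ := by
  refine ⟨fun w => f (Fin.cons false w), fun w => f (Fin.cons true w), ?_⟩
  funext w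
  rw [Pi.add_apply, levelCreation_apply, levelCreation_apply]
  conv_lhs => rw [← Fin.cons_self_tail w]
  cases w 0 <;> simp

theorem isExtension_level (n : ℕ) :
    IsExtension (levelA n) (levelS n) (levelA (n + 1)) (levelS (n + 1)) (levelCreation n) where
  map_A x f := by
    rw [levelA, Matrix.mulVecLin_apply, levelMatrix_mulVec_levelCreation, State.step, levelMatrix_e,
      Matrix.one_mulVec]
    · rfl
    all_goals simp
  map_S_false f := by
    simp only [levelS, levelA, Matrix.mulVecLin_apply, Matrix.sub_mulVec, Matrix.add_mulVec,
      levelMatrix_mulVec_levelCreation, State.out, State.step, levelMatrix_e, Matrix.one_mulVec]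
    module
  map_S_true f := by
    simp only [levelS, Matrix.mulVecLin_apply, Matrix.sub_mulVec, Matrix.add_mulVec,
      levelMatrix_mulVec_levelCreation, State.out, State.step, Matrix.one_mulVec]
    simp only [map_add, map_sub]
    abel
  eq_zero f₀ f₁ h := by
    constructor
    · funext w
      have := congrFun h (Fin.cons false w)
      simpa [levelCreation_apply] using this
    · funext w
      have := congrFun h (Fin.cons true w)
      simpa [levelCreation_apply] using this

theorem levelA_zero (v : LevelSpace 0) : levelA 0 v = v := Matrix.one_mulVec v

theorem levelS_zero (v : LevelSpace 0) : levelS 0 v = (2 : ℂ) • v := by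
  rw [levelS, Matrix.mulVecLin_apply, levelMatrix, levelMatrix, levelMatrix, Matrix.sub_mulVec,
    Matrix.add_mulVec, Matrix.add_mulVec, Matrix.one_mulVec]
  module

theorem levelA_levelA (n : ℕ) (v : LevelSpace n) : levelA n (levelA n v) = v := by
  cases n with
  | zero => rw [levelA_zero, levelA_zero]
  | succ n =>
    obtain ⟨v₀, v₁, rfl⟩ := exists_eq_levelCreation_add n v
    rw [(isExtension_level n).A_add, (isExtension_level n).A_add]

theorem levelS_levelS (n : ℕ) (v : LevelSpace n) : levelS n (levelS n v) = (4 : ℂ) • v := by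
  induction n with
  | zero => rw [levelS_zero, levelS_zero, smul_smul]; norm_num
  | succ n ih =>
    obtain ⟨v₀, v₁, rfl⟩ := exists_eq_levelCreation_add n v
    rw [(isExtension_level n).S_add, (isExtension_level n).S_add, ih]
    simp only [map_smul, levelA_levelA]
    module

theorem levelPencil_mulVec (n : ℕ) (l m : ℝ) (v : LevelSpace n) :
    (levelPencil n l m).mulVec v = -((l : ℂ) • levelA n v) + levelS n v - (m : ℂ) • v := by
  simp only [levelPencil, levelA, levelS, Matrix.mulVecLin_apply, Matrix.sub_mulVec,
    Matrix.add_mulVec, Matrix.neg_mulVec, Matrix.smul_mulVec, Matrix.one_mulVec]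
  module

theorem mem_SigmaLevel_iff (n : ℕ) (p : ℝ × ℝ) : p ∈ SigmaLevel n ↔
    ∃ v : LevelSpace n, v ≠ 0 ∧
      -((p.1 : ℂ) • levelA n v) + levelS n v - (p.2 : ℂ) • v = 0 := by
  change ¬ IsUnit (levelPencil n p.1 p.2) ↔ _
  simp only [← levelPencil_mulVec]
  rw [Matrix.exists_mulVec_eq_zero_iff, Matrix.isUnit_iff_isUnit_det, isUnit_iff_ne_zero, not_not]

/-! ### Eigenvalues of the anticommutator on the levels -/

theorem exists_level_fixed (n : ℕ) :
    ∃ v, v ≠ 0 ∧ levelA n v = v ∧ levelS n v = (2 : ℂ) • v := by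
  induction n with
  | zero => exact ⟨1, one_ne_zero, levelA_zero _, levelS_zero _⟩
  | succ n ih => exact (isExtension_level n).exists_fixed ih

/-- Since `α(1) = 1`, the first component is again an eigenvector for `4`, hence fixed by induction,
and then `(2A + S) v₀ = 4 v₀` forces equal components. This discards the second line of the
degenerate conic `m² = (l - 2)²`. -/
theorem level_fixed_of_eigenvector (n : ℕ) (v : LevelSpace n)
    (hQ : levelA n (levelS n v) + levelS n (levelA n v) = (4 : ℂ) • v) :
    levelA n v = v ∧ levelS n v = (2 : ℂ) • v := by
  induction n with
  | zero => exact ⟨levelA_zero v, levelS_zero v⟩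
  | succ n ih =>
    obtain ⟨v₀, v₁, rfl⟩ := exists_eq_levelCreation_add n v
    obtain ⟨h₁, h₀⟩ := ((isExtension_level n).Q_eq_smul_iff v₀ v₁ 4).1 hQ
    obtain ⟨hA, hS⟩ := ih v₀ (by
      rw [Q_eq_of_swap (c := 1) (levelA_levelA n) (levelS_levelS n) (by rw [h₁, mul_one])
        (by rw [h₀, mul_one])]
      norm_num)
    obtain rfl : v₁ = v₀ := by
      rw [hA, hS] at h₀
      linear_combination (norm := module) (-1 / 4 : ℂ) • h₀
    rw [(isExtension_level n).A_add, (isExtension_level n).S_add, hA, hS]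
    simp

theorem level_antifixed_of_eigenvector (n : ℕ) (v : LevelSpace (n + 1))
    (hQ : levelA (n + 1) (levelS (n + 1) v) + levelS (n + 1) (levelA (n + 1) v) = (-4 : ℂ) • v) :
    levelA (n + 1) v = -v ∧ levelS (n + 1) v = (2 : ℂ) • v := by
  obtain ⟨v₀, v₁, rfl⟩ := exists_eq_levelCreation_add n v
  obtain ⟨h₁, h₀⟩ := ((isExtension_level n).Q_eq_smul_iff v₀ v₁ (-4)).1 hQ
  obtain ⟨hA, hS⟩ := level_fixed_of_eigenvector n v₀ (by
    rw [Q_eq_of_swap (c := -1) (levelA_levelA n) (levelS_levelS n) (by rw [h₁]; norm_num)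
      (by rw [h₀]; norm_num)]
    norm_num)
  obtain rfl : v₁ = -v₀ := by
    rw [hA, hS] at h₀
    linear_combination (norm := module) (1 / 4 : ℂ) • h₀
  rw [(isExtension_level n).A_add, (isExtension_level n).S_add, map_neg, map_neg, map_neg, hA, hS]
  constructor
  · abel
  · simp

/-- Each descent by one level replaces `c` by `α(c)`, ending on level `0`, where only the eigenvalue
`4` occurs. Backwards, `1` comes from `±1`, and `-1` only from `0`; since `-1` needs level `1`, the
value `0` needs level `2`, whence `i + 2`. -/
theorem eigenvalue_level (n : ℕ) {c : ℝ} {v : LevelSpace (n + 1)} (hv : v ≠ 0)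
    (hQ : levelA (n + 1) (levelS (n + 1) v) + levelS (n + 1) (levelA (n + 1) v) =
      (4 * (c : ℂ)) • v) :
    c = 1 ∨ c = -1 ∨ ∃ θ : Set.Icc (-1 : ℝ) 1, (θ : ℝ) = c ∧ ∃ i : ℕ, i + 2 ≤ n + 1 ∧
      ((alpha^[i] θ : Set.Icc (-1 : ℝ) 1) : ℝ) = 0 := by
  obtain ⟨v₀, v₁, rfl⟩ := exists_eq_levelCreation_add n v
  obtain ⟨h₁, h₀⟩ := ((isExtension_level n).Q_eq_smul_iff v₀ v₁ (4 * (c : ℂ))).1 hQ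
  obtain ⟨w, hw, hQw⟩ : ∃ w, w ≠ 0 ∧ levelA n (levelS n w) + levelS n (levelA n w) =
      (4 * ((2 * c ^ 2 - 1 : ℝ) : ℂ)) • w := by
    push_cast
    by_cases hv₀ : v₀ = 0
    · refine ⟨v₁, ?_, Q_eq_of_swap (levelA_levelA n) (levelS_levelS n) h₀ h₁⟩
      rintro rfl
      exact hv (by simp [hv₀])
    · exact ⟨v₀, hv₀, Q_eq_of_swap (levelA_levelA n) (levelS_levelS n) h₁ h₀⟩
  have hone : 2 * c ^ 2 - 1 = 1 → c = 1 ∨ c = -1 := fun h => by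
    rw [← sq_eq_one_iff]
    linarith
  cases n with
  | zero =>
    rw [levelA_zero, levelA_zero, levelS_zero] at hQw
    have h4 : (4 - 4 * ((2 * c ^ 2 - 1 : ℝ) : ℂ)) • w = 0 := by
      linear_combination (norm := module) hQw
    have h5 := (smul_eq_zero.1 h4).resolve_right hw
    have h6 : (4 - 4 * (2 * c ^ 2 - 1) : ℝ) = 0 := by exact_mod_cast h5
    rcases hone (by linarith) with h | h
    · exact Or.inl h
    · exact Or.inr (Or.inl h)
  | succ n =>
    rcases eigenvalue_level n hw hQw with h | h | ⟨θ, hθ, i, hi, h⟩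
    · rcases hone h with h | h
      · exact Or.inl h
      · exact Or.inr (Or.inl h)
    · have hc : c = 0 := by
        have : c ^ 2 = 0 := by linarith
        simpa using this
      subst hc
      exact Or.inr (Or.inr ⟨⟨0, by norm_num⟩, rfl, 0, by lia, rfl⟩)
    · have hc : c ∈ Set.Icc (-1 : ℝ) 1 := by
        rw [Set.mem_Icc, ← abs_le, ← sq_le_one_iff_abs_le_one]
        linarith [θ.2.2]
      refine Or.inr (Or.inr ⟨⟨c, hc⟩, rfl, i + 1, by lia, ?_⟩)
      have e : alpha ⟨c, hc⟩ = θ := Subtype.ext hθ.symm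
      rwa [Function.iterate_succ_apply, e]

theorem exists_level_eigenvector {n i : ℕ} (hi : i + 2 ≤ n) {θ : Set.Icc (-1 : ℝ) 1}
    (h : ((alpha^[i] θ : Set.Icc (-1 : ℝ) 1) : ℝ) = 0) :
    ∃ v, v ≠ 0 ∧ levelA n (levelS n v) + levelS n (levelA n v) = (4 * ((θ : ℝ) : ℂ)) • v := by
  induction i generalizing θ n with
  | zero =>
    obtain ⟨n, rfl⟩ := Nat.exists_eq_add_of_le' hi
    have h' : (θ : ℝ) = 0 := h
    rw [h', Complex.ofReal_zero]
    exact (isExtension_level (n + 1)).exists_eigenvector_zero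
      ((isExtension_level n).exists_antifixed (exists_level_fixed n))
  | succ i ih =>
    by_cases h0 : (θ : ℝ) = 0
    · obtain ⟨n, rfl⟩ := Nat.exists_eq_add_of_le' (show 2 ≤ n by lia)
      rw [h0, Complex.ofReal_zero]
      exact (isExtension_level (n + 1)).exists_eigenvector_zero
        ((isExtension_level n).exists_antifixed (exists_level_fixed n))
    · obtain ⟨n, rfl⟩ := Nat.exists_eq_add_of_le' (show 1 ≤ n by lia)
      refine (isExtension_level n).exists_eigenvector (levelA_levelA n) (levelS_levelS n)
        (Complex.ofReal_ne_zero.2 h0) ?_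
      have := ih (n := n) (θ := alpha θ) (by lia) h
      rw [coe_alpha] at this
      push_cast at this
      exact this

/-! ### The spectra on the levels as lines and hyperbolas -/

theorem SigmaLevel_zero : SigmaLevel 0 = {p | p.1 + p.2 - 2 = 0} := by
  ext ⟨l, m⟩
  rw [mem_SigmaLevel_iff]
  simp only [levelA_zero, levelS_zero]
  have e : ∀ v : LevelSpace 0, -((l : ℂ) • v) + (2 : ℂ) • v - (m : ℂ) • v =
      ((-(l + m - 2) : ℝ) : ℂ) • v := fun v => by push_cast; module
  simp only [e]
  constructor
  · rintro ⟨v, hv, h⟩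
    have := (smul_eq_zero.1 h).resolve_right hv
    rw [Complex.ofReal_eq_zero, neg_eq_zero] at this
    exact this
  · intro h
    have h' : l + m - 2 = 0 := h
    exact ⟨1, one_ne_zero, by rw [h']; simp⟩

theorem mem_SigmaLevel_of_line₁ (n : ℕ) {p : ℝ × ℝ} (hp : p.1 + p.2 - 2 = 0) :
    p ∈ SigmaLevel n := by
  obtain ⟨v, hv, hA, hS⟩ := exists_level_fixed n
  refine (mem_SigmaLevel_iff n p).2 ⟨v, hv, ?_⟩
  have h0 : (p.1 + p.2 - 2 : ℂ) • v = 0 := by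
    rw [(by exact_mod_cast hp : (p.1 + p.2 - 2 : ℂ) = 0), zero_smul]
  rw [hA, hS]
  linear_combination (norm := module) (-1 : ℂ) • h0

theorem mem_SigmaLevel_of_line₂ (n : ℕ) {p : ℝ × ℝ} (hp : p.1 - p.2 + 2 = 0) :
    p ∈ SigmaLevel (n + 1) := by
  obtain ⟨v, hv, hA, hS⟩ := (isExtension_level n).exists_antifixed (exists_level_fixed n)
  refine (mem_SigmaLevel_iff _ p).2 ⟨v, hv, ?_⟩
  have h0 : (p.1 - p.2 + 2 : ℂ) • v = 0 := by
    rw [(by exact_mod_cast hp : (p.1 - p.2 + 2 : ℂ) = 0), zero_smul]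
  rw [hA, hS]
  linear_combination (norm := module) h0

theorem mem_SigmaLevel_of_hyperbola {n i : ℕ} (hi : i + 2 ≤ n) {θ : Set.Icc (-1 : ℝ) 1}
    (h : ((alpha^[i] θ : Set.Icc (-1 : ℝ) 1) : ℝ) = 0) {p : ℝ × ℝ} (hp : p ∈ hyperbola θ) :
    p ∈ SigmaLevel n := by
  obtain ⟨l, m⟩ := p
  have hp' : 4 - m ^ 2 + l ^ 2 + 4 * l * (θ : ℝ) = 0 := hp
  obtain ⟨θ', hθ', h'⟩ := exists_neg_iterate_alpha h
  obtain ⟨v, hv, hQ⟩ := exists_level_eigenvector hi h'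
  have hc : (((θ' : ℝ) : ℂ)) ^ 2 ≠ 1 := by
    exact_mod_cast sq_ne_one_of_iterate_alpha h'
  have hlm : 4 - (m : ℂ) ^ 2 + (l : ℂ) ^ 2 = 4 * l * ((θ' : ℝ) : ℂ) := by
    rw [hθ']
    exact_mod_cast (by linarith : 4 - m ^ 2 + l ^ 2 = 4 * l * -(θ : ℝ))
  exact (mem_SigmaLevel_iff n _).2
    (exists_kernel_of_eigenvector (levelA_levelA n) (levelS_levelS n) hc hlm hv hQ)

theorem hyperbola_of_mem_SigmaLevel {n : ℕ} {p : ℝ × ℝ} (hp : p ∈ SigmaLevel (n + 1)) :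
    p.1 + p.2 - 2 = 0 ∨ p.1 - p.2 + 2 = 0 ∨ ∃ θ : Set.Icc (-1 : ℝ) 1, (∃ i : ℕ, i + 2 ≤ n + 1 ∧
      ((alpha^[i] θ : Set.Icc (-1 : ℝ) 1) : ℝ) = 0) ∧ p ∈ hyperbola θ := by
  obtain ⟨v, hv, h⟩ := (mem_SigmaLevel_iff _ p).1 hp
  obtain ⟨l, m⟩ := p
  dsimp only at h ⊢
  have hA := levelA_levelA (n + 1)
  have hS := levelS_levelS (n + 1)
  set A := levelA (n + 1) with hAdef
  set S := levelS (n + 1) with hSdef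
  have hX : S v = (l : ℂ) • A v + (m : ℂ) • v := by
    linear_combination (norm := module) h
  have hAS : A (S v) = (l : ℂ) • v + (m : ℂ) • A v := by rw [hX, map_add, map_smul, map_smul, hA]
  have hSA : (l : ℂ) • S (A v) = (4 : ℂ) • v - (m : ℂ) • S v := by
    rw [← hS v]
    conv_rhs => rw [hX]
    rw [map_add, map_smul, map_smul, hX]
    module
  -- A kernel vector of the pencil is itself an eigenvector of `Q` when `l ≠ 0`; for `l = 0` this
  -- only says `m² = 4`.
  have hQ : (l : ℂ) • (A (S v) + S (A v)) = (4 - (m : ℂ) ^ 2 + (l : ℂ) ^ 2) • v := by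
    rw [smul_add, hSA, hAS, hX]
    module
  by_cases hl : l = 0
  · subst hl
    rw [Complex.ofReal_zero, zero_smul] at hQ
    have h0 := (smul_eq_zero.1 hQ.symm).resolve_right hv
    have h1 : 4 - m ^ 2 + 0 ^ 2 = 0 := by exact_mod_cast h0
    have h2 : (m - 2) * (m + 2) = 0 := by linear_combination -h1
    rcases mul_eq_zero.1 h2 with h3 | h3
    · left; linarith
    -- The point `(0, -2)` lies on neither line. On level `1` it is excluded because `S` is the
    -- scalar `2` there; from level `2` on it lies on the hyperbola with `θ = 0`.
    · cases n with
      | zero =>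
        exfalso
        obtain rfl : m = -2 := by linarith
        obtain ⟨v₀, v₁, rfl⟩ := exists_eq_levelCreation_add 0 v
        have h4 : S (levelCreation 0 false v₀ + levelCreation 0 true v₁) =
            (2 : ℂ) • (levelCreation 0 false v₀ + levelCreation 0 true v₁) := by
          rw [hSdef, (isExtension_level 0).S_add, levelA_zero, levelS_zero]
          simp
        rw [h4] at hX
        push_cast at hX
        refine hv ?_
        linear_combination (norm := module) (1 / 4 : ℂ) • hX
      | succ n =>
        refine Or.inr (Or.inr ⟨⟨0, by norm_num⟩, ⟨0, by lia, rfl⟩, ?_⟩)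
        change 4 - m ^ 2 + 0 ^ 2 + 4 * 0 * 0 = (0 : ℝ)
        linarith
  · have hl' : (l : ℂ) ≠ 0 := Complex.ofReal_ne_zero.2 hl
    have hQ' : A (S v) + S (A v) = (4 * (((4 - m ^ 2 + l ^ 2) / (4 * l) : ℝ) : ℂ)) • v := by
      rw [← inv_smul_smul₀ hl' (A (S v) + S (A v)), hQ, smul_smul]
      congr 1
      push_cast
      field_simp
    rcases eigenvalue_level n hv hQ' with h1 | h1 | ⟨θ, hθ, i, hi, h1⟩
    · left
      rw [h1] at hQ'
      obtain ⟨h2, h3⟩ := level_fixed_of_eigenvector (n + 1) v (by rw [hQ']; norm_num)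
      rw [← hAdef] at h2
      rw [← hSdef, hX, h2] at h3
      have h4 : ((l + m - 2 : ℝ) : ℂ) • v = 0 := by
        push_cast
        linear_combination (norm := module) h3
      exact Complex.ofReal_eq_zero.1 ((smul_eq_zero.1 h4).resolve_right hv)
    · right; left
      rw [h1] at hQ'
      obtain ⟨h2, h3⟩ := level_antifixed_of_eigenvector n v (by rw [hQ']; norm_num)
      rw [← hAdef] at h2
      rw [← hSdef, hX, h2] at h3
      have h4 : ((l - m + 2 : ℝ) : ℂ) • v = 0 := by
        push_cast
        linear_combination (norm := module) (-1 : ℂ) • h3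
      exact Complex.ofReal_eq_zero.1 ((smul_eq_zero.1 h4).resolve_right hv)
    · right; right
      obtain ⟨θ', hθ', h'⟩ := exists_neg_iterate_alpha h1
      refine ⟨θ', ⟨i, hi, h'⟩, ?_⟩
      change 4 - m ^ 2 + l ^ 2 + 4 * l * (θ' : ℝ) = 0
      rw [hθ', hθ]
      field_simp
      ring

theorem SigmaLevel_eq {n : ℕ} (hn : 1 ≤ n) :
    SigmaLevel n =
      {p | p.1 + p.2 - 2 = 0} ∪ {p | p.1 - p.2 + 2 = 0} ∪
        ⋃ θ ∈ {θ : Set.Icc (-1 : ℝ) 1 | ∃ i : ℕ, i + 2 ≤ n ∧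
            ((alpha^[i] θ : Set.Icc (-1 : ℝ) 1) : ℝ) = 0},
          hyperbola (θ : ℝ) := by
  obtain ⟨n, rfl⟩ := Nat.exists_eq_add_of_le' hn
  ext p
  rw [Set.mem_union, Set.mem_union, or_assoc, Set.mem_iUnion₂]
  constructor
  · intro hp
    rcases hyperbola_of_mem_SigmaLevel hp with h | h | ⟨θ, hθ, h⟩
    · exact Or.inl h
    · exact Or.inr (Or.inl h)
    · exact Or.inr (Or.inr ⟨θ, hθ, h⟩)
  · rintro (h | h | ⟨θ, ⟨i, hi, hθ⟩, h⟩)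
    · exact mem_SigmaLevel_of_line₁ _ h
    · exact mem_SigmaLevel_of_line₂ _ h
    · exact mem_SigmaLevel_of_hyperbola hi hθ h

/-! ### Block elimination and invariance on the levels -/

theorem mem_SigmaLevel_succ_iff (n : ℕ) (p : ℝ × ℝ) : p ∈ SigmaLevel (n + 1) ↔
    ∃ v₀ v₁ : LevelSpace n, (v₀ ≠ 0 ∨ v₁ ≠ 0) ∧
      (2 : ℂ) • levelA n v₀ - (p.2 : ℂ) • v₀ = (p.1 : ℂ) • v₁ ∧
      levelS n v₁ - (p.2 : ℂ) • v₁ = (p.1 : ℂ) • v₀ := by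
  rw [mem_SigmaLevel_iff]
  constructor
  · rintro ⟨v, hv, h⟩
    obtain ⟨v₀, v₁, rfl⟩ := exists_eq_levelCreation_add n v
    refine ⟨v₀, v₁, ?_, ((isExtension_level n).pencil_eq_zero_iff v₀ v₁ _ _).1 h⟩
    by_contra! h0
    exact hv (by simp [h0.1, h0.2])
  · rintro ⟨v₀, v₁, hv, h⟩
    refine ⟨_, fun h0 => ?_, ((isExtension_level n).pencil_eq_zero_iff v₀ v₁ _ _).2 h⟩
    obtain ⟨h₀, h₁⟩ := (isExtension_level n).eq_zero _ _ h0
    exact hv.elim (· h₀) (· h₁)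

section Solve

variable {V : Type*} [AddCommGroup V] [Module ℂ V]

theorem sub_smul_eq_iff_of_sq {E : V →ₗ[ℂ] V} (hE : ∀ v, E (E v) = (4 : ℂ) • v) {m : ℂ}
    (hm : 4 - m ^ 2 ≠ 0) (v w : V) :
    E v - m • v = w ↔ v = (4 - m ^ 2)⁻¹ • (E w + m • w) := by
  constructor
  · rintro rfl
    rw [eq_inv_smul_iff₀ hm]
    simp only [map_sub, map_smul, hE]
    module
  · rintro rfl
    simp only [map_smul, map_add, hE]
    match_scalars
    · field_simp
    · ring

end Solve

/-- Solving the first block equation for `v₀`, possible since `2A - m` is invertible, turns the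
second into the pencil at `G p` applied to `v₁`. -/
theorem G_mem_SigmaLevel_iff (n : ℕ) {p : ℝ × ℝ} (hp : p ∈ schurDomain) :
    G p ∈ SigmaLevel n ↔ p ∈ SigmaLevel (n + 1) := by
  obtain ⟨l, m⟩ := p
  have hm : m ^ 2 ≠ 4 := hp
  have hk : (4 - (m : ℂ) ^ 2) ≠ 0 := by
    simpa using ofReal_sub_ne_zero (w := 1) (m := m) (by simpa using hm)
  have hA : ∀ v, ((2 : ℂ) • levelA n) (((2 : ℂ) • levelA n) v) = (4 : ℂ) • v := fun v => by
    rw [LinearMap.smul_apply, LinearMap.smul_apply, map_smul, levelA_levelA, smul_smul]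
    norm_num
  have key : ∀ v : LevelSpace n,
      -(((G (l, m)).1 : ℂ) • levelA n v) + levelS n v - ((G (l, m)).2 : ℂ) • v =
        levelS n v - (m : ℂ) • v - (l : ℂ) • (4 - (m : ℂ) ^ 2)⁻¹ •
          ((2 : ℂ) • levelA n ((l : ℂ) • v) + (m : ℂ) • (l : ℂ) • v) := by
    intro v
    simp only [G, map_smul]
    push_cast
    match_scalars <;> field_simp
    ring
  rw [mem_SigmaLevel_succ_iff, mem_SigmaLevel_iff]
  simp only [key]
  constructor
  · rintro ⟨v, hv, h⟩
    exact ⟨_, v, Or.inr hv, (sub_smul_eq_iff_of_sq hA hk _ _).2 rfl, sub_eq_zero.1 h⟩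
  · rintro ⟨v₀, v₁, hv, h₀, h₁⟩
    have h := (sub_smul_eq_iff_of_sq hA hk _ _).1 h₀
    refine ⟨v₁, ?_, ?_⟩
    · rintro rfl
      simp only [smul_zero, map_zero, add_zero] at h
      exact hv.elim (· h) (· rfl)
    · rw [h₁, sub_eq_zero]
      exact congrArg _ h

theorem F_mem_SigmaLevel_iff (n : ℕ) {p : ℝ × ℝ} (hp : p ∈ schurDomain) :
    (p.1 ≠ 0 ∧ F p ∈ SigmaLevel n) ↔ p ∈ SigmaLevel (n + 1) := by
  obtain ⟨l, m⟩ := p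
  have hm : m ^ 2 ≠ 4 := hp
  have hk : (4 - (m : ℂ) ^ 2) ≠ 0 := by
    simpa using ofReal_sub_ne_zero (w := 1) (m := m) (by simpa using hm)
  have hA : ∀ v, ((2 : ℂ) • levelA n) (((2 : ℂ) • levelA n) v) = (4 : ℂ) • v := fun v => by
    rw [LinearMap.smul_apply, LinearMap.smul_apply, map_smul, levelA_levelA, smul_smul]
    norm_num
  have key : l ≠ 0 → ∀ v : LevelSpace n,
      -(((F (l, m)).1 : ℂ) • levelA n v) + levelS n v - ((F (l, m)).2 : ℂ) • v = 0 ↔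
        (2 : ℂ) • levelA n v - (m : ℂ) • v = (l : ℂ) • (4 - (m : ℂ) ^ 2)⁻¹ •
          (levelS n ((l : ℂ) • v) + (m : ℂ) • (l : ℂ) • v) := by
    intro hl v
    have hl' : (l : ℂ) ≠ 0 := Complex.ofReal_ne_zero.2 hl
    have e : -(((F (l, m)).1 : ℂ) • levelA n v) + levelS n v - ((F (l, m)).2 : ℂ) • v =
        (-(4 - (m : ℂ) ^ 2) / (l : ℂ) ^ 2) • ((2 : ℂ) • levelA n v - (m : ℂ) • v -
          (l : ℂ) • (4 - (m : ℂ) ^ 2)⁻¹ •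
            (levelS n ((l : ℂ) • v) + (m : ℂ) • (l : ℂ) • v)) := by
      simp only [F, map_smul]
      push_cast
      match_scalars <;> field_simp
      ring
    have hne : -(4 - (m : ℂ) ^ 2) / (l : ℂ) ^ 2 ≠ 0 :=
      div_ne_zero (neg_ne_zero.2 hk) (pow_ne_zero 2 hl')
    rw [e, smul_eq_zero_iff_right hne, sub_eq_zero]
  rw [mem_SigmaLevel_succ_iff, mem_SigmaLevel_iff]
  constructor
  · rintro ⟨hl, v, hv, h⟩
    exact ⟨v, _, Or.inl hv, (key hl v).1 h,
      (sub_smul_eq_iff_of_sq (levelS_levelS n) hk _ _).2 rfl⟩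
  · rintro ⟨v₀, v₁, hv, h₀, h₁⟩
    have h := (sub_smul_eq_iff_of_sq (levelS_levelS n) hk _ _).1 h₁
    have h' := (sub_smul_eq_iff_of_sq hA hk _ _).1 h₀
    dsimp only at h h' h₀ ⊢
    -- For `l = 0` the system decouples into two equations with invertible operators, leaving only
    -- the zero solution.
    have hl : l ≠ 0 := by
      rintro rfl
      simp only [Complex.ofReal_zero, zero_smul, smul_zero, map_zero, add_zero] at h h'
      exact hv.elim (· h') (· h)
    refine ⟨hl, v₀, ?_, ?_⟩
    · rintro rfl
      simp only [smul_zero, map_zero, add_zero] at h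
      exact hv.elim (· rfl) (· h)
    · rw [key hl, h₀, ← h]

theorem SigmaLevel_inter_eq_F (n : ℕ) : SigmaLevel (n + 1) ∩ schurDomain =
    {p | p ∈ schurDomain ∧ p.1 ≠ 0 ∧ F p ∈ SigmaLevel n} := by
  ext p
  exact ⟨fun ⟨h, hU⟩ => ⟨hU, (F_mem_SigmaLevel_iff n hU).2 h⟩,
    fun ⟨hU, h⟩ => ⟨(F_mem_SigmaLevel_iff n hU).1 h, hU⟩⟩

theorem SigmaLevel_inter_eq_G (n : ℕ) : SigmaLevel (n + 1) ∩ schurDomain =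
    {p | p ∈ schurDomain ∧ G p ∈ SigmaLevel n} := by
  ext p
  exact ⟨fun ⟨h, hU⟩ => ⟨hU, (G_mem_SigmaLevel_iff n hU).2 h⟩,
    fun ⟨hU, h⟩ => ⟨(G_mem_SigmaLevel_iff n hU).1 h, hU⟩⟩

end Grigorchuk

theorem mainTheorem4 :
    -- I. the Schur maps on the pencil, in homogeneous coordinates
    ((∀ l m w : ℝ,
        (IsUnit (block (rep (homPencil (l, m, w))) true true) ↔
          m ^ 2 ≠ 4 * w ^ 2) ∧
        (IsUnit (block (rep (homPencil (l, m, w))) false false) ↔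
          m ^ 2 ≠ 4 * w ^ 2) ∧
        (m ^ 2 ≠ 4 * w ^ 2 →
          SameClass
            (schur₁ (rep (homPencil (l, m, w))))
            (rep (homPencil (homF (l, m, w)))) ∧
          SameClass
            (schur₂ (rep (homPencil (l, m, w))))
            (rep (homPencil (homG (l, m, w)))))) ∧
      -- and in affine coordinates
      (∀ lam mu : ℝ, mu ^ 2 ≠ 4 →
        (lam ≠ 0 → SameClass
          (schur₁ (rep (pencil lam mu)))
          (rep (pencil (F (lam, mu)).1
            (F (lam, mu)).2))) ∧
        SameClass
          (schur₂ (rep (pencil lam mu)))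
          (rep (pencil (G (lam, mu)).1
            (G (lam, mu)).2)))) ∧
    -- II. invariance, on the common domain of the Schur maps
    ((SigmaSet ∩ schurDomain =
          {p | p ∈ schurDomain ∧ p.1 ≠ 0 ∧ F p ∈ SigmaSet}) ∧
      (SigmaSet ∩ schurDomain =
          {p | p ∈ schurDomain ∧ G p ∈ SigmaSet}) ∧
      ∀ n : ℕ,
        (SigmaLevel (n + 1) ∩ schurDomain =
          {p | p ∈ schurDomain ∧ p.1 ≠ 0 ∧
            F p ∈ SigmaLevel n}) ∧
        (SigmaLevel (n + 1) ∩ schurDomain =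
          {p | p ∈ schurDomain ∧ G p ∈ SigmaLevel n})) ∧
    -- III. the spectrum
    (SigmaSet = {p | |(|p.1| - 2)| ≤ |p.2| ∧ |p.2| ≤ |p.1| + 2}) ∧
    -- IV. the spectra on the levels
    (SigmaLevel 0 = {p | p.1 + p.2 - 2 = 0} ∧
      ∀ n : ℕ, 1 ≤ n →
        SigmaLevel n =
          {p | p.1 + p.2 - 2 = 0} ∪ {p | p.1 - p.2 + 2 = 0} ∪
            ⋃ θ ∈ {θ : Set.Icc (-1 : ℝ) 1 | ∃ i : ℕ, i + 2 ≤ n ∧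
                ((alpha^[i] θ : Set.Icc (-1 : ℝ) 1) : ℝ) = 0},
              hyperbola (θ : ℝ)) := by
  refine ⟨⟨fun l m w => ⟨isUnit_block_true_iff l m w, isUnit_block_false_iff l m w,
      fun h => ⟨sameClass_schur₁ h, sameClass_schur₂ h⟩⟩,
    fun lam mu h => ⟨sameClass_schur₁_pencil h, sameClass_schur₂_pencil h⟩⟩,
    ⟨SigmaSet_inter_eq_F, SigmaSet_inter_eq_G,
      fun n => ⟨SigmaLevel_inter_eq_F n, SigmaLevel_inter_eq_G n⟩⟩,
    SigmaSet_eq, SigmaLevel_zero, fun n hn => SigmaLevel_eq hn⟩
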